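/- Let $s\in(1/2,1)$, $N\ge 1$, $1\le k\le N$. Let $C_s=\frac{4^s s\,\Gamma(1/2+s)}{\sqrt{\pi}\,\Gamma(1-s)}>0$ be the normalizing constant of the one-dimensional fractional Laplacian, and let $\mathcal V_k$ be the set of orthonormal $k$-tuples $(\xi_1,\dots,\xi_k)$ in $\mathbb R^N$. For $u:\mathbb R^N\to\mathbb R$, $x_0\in\mathbb R^N$, $\delta>0$ and $\varphi\in C^2(B_\delta(x_0))$ put $$\mathcal I_k^+(u,\varphi,x_0,\delta)=\sup_{(\xi_i)\in\mathcal V_k}\sum_{i=1}^k\Big(C_s\,\mathrm{P.V.}\!\int_{-\delta}^{\delta}\frac{\varphi(x_0+\tau\xi_i)-\varphi(x_0)}{|\tau|^{1+2s}}\,d\tau+C_s\int_{|\tau|\ge\delta}\frac{u(x_0+\tau\xi_i)-u(x_0)}{|\tau|^{1+2s}}\,d\tau\Big),$$ where the integrals take values in $[-\infty,+\infty]$ and $\mathrm{P.V.}\int_{-r}^{r}f\,d\tau=\int_0^r[f(\tau)+f(-\tau)]\,d\tau$ for $0<r\le\infty$. A function $u:\mathbb R^N\to\mathbb R$ is a viscosity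 supersolution of $\mathcal I_k^+u=0$ in $\mathbb R^N$ if it is lower semicontinuous and $\mathcal I_k^+(u,\varphi,x_0,\delta)\le 0$ for all $x_0\in\mathbb R^N$, $\delta>0$ and $\varphi\in C^2(B_\delta(x_0))$ such that $u-\varphi$ attains its minimum over $B_\delta(x_0)$ at $x_0$. For $\gamma\in(0,1)$ let $c_k(\gamma)=\hat c(\gamma)+(k-1)c^\perp(\gamma)$, where $$\hat c(\gamma)=C_s\,\mathrm{P.V.}\!\int_{-\infty}^{+\infty}\big[|1+\tau|^{-\gamma}-1\big]\,|\tau|^{-(1+2s)}\,d\tau,\qquad c^\perp(\gamma)=2C_s\int_0^{+\infty}\big[(1+\tau^2)^{-\gamma/2}-1\big]\,\tau^{-(1+2s)}\,d\tau .$$ **Theorem.** (i) For $k=1$, every viscosity supersolution of $\mathcal I_1^+u=0$ in $\mathbb R^N$ that is bounded from below is constant. (ii) For $2\le k\le N$ there exist nonconstant viscosity supersolutions of $\mathcal I_k^+u=0$ in $\mathbb R^N$ that are bounded from below. More precisely, $c_k$ has exactly one zero $\bar\gamma$ in $(0,1)$, and for every $0<\gamma<\bar\gamma$ the function $u(x)=\min\{1,|x|^{-\gamma}\}$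 (with $u(0)=1$) is a nonconstant viscosity supersolution of $\mathcal I_k^+u=0$ in $\mathbb R^N$ that is bounded from below. -/

import Mathlib

open Set MeasureTheory

noncomputable section

/-- The normalizing constant `C_s = C_{1,s}` of the one-dimensional fractional Laplacian,
`4 ^ s * s * Γ(1/2 + s) / (√π * Γ(1 - s))`, which is positive for `0 < s < 1`. -/
def fracConst (s : ℝ) : ℝ :=
  4 ^ s * s * Real.Gamma (1 / 2 + s) / (Real.sqrt Real.pi * Real.Gamma (1 - s))

/-- The integral of a real function over `S` with values in `[-∞, +∞]`: the integral of the
positive part minus the integral of the negative part. It is the usual extended integral whenever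
one of the two parts is finite, and it is the Lebesgue integral when `f` is integrable on `S`. -/
def extIntegral (S : Set ℝ) (f : ℝ → ℝ) : EReal :=
  ((∫⁻ τ in S, ENNReal.ofReal (f τ) : ENNReal) : EReal) -
    ((∫⁻ τ in S, ENNReal.ofReal (-(f τ)) : ENNReal) : EReal)

/-- The principal value (at the origin) of the integral of `f` over `(-r, r)`, in symmetrized
form: the integral over `(0, r)` of `f τ + f (-τ)`. -/
def pvExtIntegral (r : ℝ) (f : ℝ → ℝ) : EReal :=
  extIntegral (Ioo 0 r) (fun τ => f τ + f (-τ))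

/-- The principal value (at the origin) of the integral of `f` over the real line, in symmetrized
form, as a real number. -/
def pvIntegral (f : ℝ → ℝ) : ℝ :=
  ∫ τ in Ioi (0 : ℝ), (f τ + f (-τ))

/-- The integrand `C_s [v (x + τ ξ) - v x] |τ| ^ (-(1 + 2 s))` of the one-dimensional nonlocal
operator in the direction `ξ`. -/
def lineIntegrand {N : ℕ} (s : ℝ) (v : EuclideanSpace ℝ (Fin N) → ℝ)
    (x ξ : EuclideanSpace ℝ (Fin N)) (τ : ℝ) : ℝ :=
  fracConst s * ((v (x + τ • ξ) - v x) * |τ| ^ (-(1 + 2 * s)))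

/-- `𝓘_k⁺(u, φ, x, δ)`: the supremum, over the orthonormal `k`-frames `ξ`, of the sum over the
frame of the principal value of the integral of `φ` over `(-δ, δ)` and of the integral of `u`
over the complement of `(-δ, δ)`. -/
def extremalPlus {N : ℕ} (s : ℝ) (k : ℕ) (u φ : EuclideanSpace ℝ (Fin N) → ℝ)
    (x : EuclideanSpace ℝ (Fin N)) (δ : ℝ) : EReal :=
  ⨆ ξ : {ξ : Fin k → EuclideanSpace ℝ (Fin N) // Orthonormal ℝ ξ},
    ∑ i, (pvExtIntegral δ (lineIntegrand s φ x (ξ.1 i)) +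
      extIntegral (Ioo (-δ) δ)ᶜ (lineIntegrand s u x (ξ.1 i)))

/-- `u` is a viscosity supersolution of `𝓘_k⁺ u = 0` in the whole space: `u` is lower
semicontinuous, and `𝓘_k⁺(u, φ, x₀, δ) ≤ 0` for every point `x₀`, every `δ > 0` and every `C²`
function `φ` on the ball `B_δ(x₀)` such that `u - φ` has a minimum over that ball at `x₀`. -/
def IsViscositySupersolution {N : ℕ} (s : ℝ) (k : ℕ)
    (u : EuclideanSpace ℝ (Fin N) → ℝ) : Prop :=
  LowerSemicontinuous u ∧
    ∀ (x₀ : EuclideanSpace ℝ (Fin N)) (δ : ℝ) (φ : EuclideanSpace ℝ (Fin N) → ℝ),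
      0 < δ → ContDiffOn ℝ 2 φ (Metric.ball x₀ δ) →
      IsMinOn (fun y => u y - φ y) (Metric.ball x₀ δ) x₀ →
      extremalPlus s k u φ x₀ δ ≤ 0

/-- `ĉ(γ)`: the value at a unit vector `e` of the operator in the direction `e` applied to
`|x| ^ (-γ)`. -/
def cRadial (s γ : ℝ) : ℝ :=
  fracConst s * pvIntegral (fun τ => (|1 + τ| ^ (-γ) - 1) * |τ| ^ (-(1 + 2 * s)))

/-- `c^⊥(γ)`: the value at a unit vector `e` of the operator in a direction orthogonal to `e`
applied to `|x| ^ (-γ)`. -/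
def cPerp (s γ : ℝ) : ℝ :=
  2 * fracConst s *
    ∫ τ in Ioi (0 : ℝ), ((1 + τ ^ 2) ^ (-γ / 2) - 1) * τ ^ (-(1 + 2 * s))

/-- `c_k(γ) = ĉ(γ) + (k - 1) c^⊥(γ)`. -/
def cExtremal (s : ℝ) (k : ℕ) (γ : ℝ) : ℝ :=
  cRadial s γ + ((k : ℝ) - 1) * cPerp s γ

/-- The function `min {1, |x| ^ (-γ)}`, with `|0| ^ (-γ) = +∞`, so that its value at `0` is `1`. -/
def truncPower {N : ℕ} (γ : ℝ) (x : EuclideanSpace ℝ (Fin N)) : ℝ :=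
  if x = 0 then 1 else min 1 (‖x‖ ^ (-γ))

end

/-!
The sign of the one-dimensional operator on small powers of `|x|` decides both parts, and it is the
sign of the operator on `log |x|`. Along the radial line through a unit vector that value is
`radialLog s`, the integral over `(0, ∞)` of `log |1 - τ ^ 2| * τ ^ (-(1 + 2 * s))`, up to a positive
factor. It vanishes for `s = 1 / 2` by an explicit primitive (`radialLog_half`). Since
`log |1 - τ ^ 2|` changes sign only at `√2` and the weights for different `s` differ by a monotone
factor, it is negative for `s > 1 / 2` (`radialLog_neg`) and positive for `s < 1 / 2`
(`radialLog_pos`).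

*The case `k = 1`.* As `radialLog s < 0`, the operator in the radial direction is strictly negative
on `|x| ^ b` for some small `b > 0` (`exists_cRadial_neg`). For a supersolution `u` bounded below and
a point `z`, the coercive function `u + ε * |x - z| ^ b` attains its minimum. The minimum point can
only be `z`, for elsewhere `-ε * |x - z| ^ b` would be a smooth strict subsolution touching `u` from
below (`not_isMinOn_add_rpow_norm`). Letting `ε → 0` gives `u z ≤ u y` for all `y`, and `z` is
arbitrary.

*The case `2 ≤ k`.* The function `cExtremal s k` is convex on `(0, 1)`, it is negative near `0`, and
it is positive somewhere because the radial coefficient blows up at `1`; hence it has exactly one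
zero and is negative before it (`exists_unique_zero_cExtremal`). Negativity near `0` holds because
the derivative at `0` is a negative multiple of `radialLog s + (k - 1) * perpLog s`, where
`perpLog s ≥ 0` and `radialLog s + perpLog s = radialLog (s / 2) / 2 > 0` by the substitution
`t = τ ^ 2`.

Let `γ` be smaller than the zero. Inside the closed unit ball the truncated power attains its
maximum, and every direction contributes a nonpositive amount. Outside, it is compared with
`|x| ^ (-γ)`. In the direction `ξ` the operator on this power is bounded by an interpolation between
the orthogonal and the radial coefficients that is affine in the square of the cosine of the angle
(`rpow_neg_symm_add_le_interp`); summing over a frame, Bessel's inequality bounds the total by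
`cExtremal s k γ < 0` (`sum_fracConst_mul_integral_profile_le`).
-/

noncomputable section

open Filter Topology

/-! ### Expansion of the one-dimensional operator on powers of the distance -/

/-- A weight on `(0, ∞)` dominating, up to constants, the symmetrized integrands below. At the origin
it has the order `τ ^ 2 * τ ^ (-(1 + 2 * s))` left by the cancellation in the principal value; away
from it, it dominates `(y ^ p + y ^ (-p)) * τ ^ (-(1 + 2 * s))` for all `y` between `|1 - τ|` and
`1 + τ`. -/
def domWeight (s p τ : ℝ) : ℝ :=
  if τ ≤ 1 / 2 then τ ^ (1 - 2 * s) else ((1 + τ) ^ p + |1 - τ| ^ (-p)) * τ ^ (-(1 + 2 * s))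

theorem integrableOn_abs_one_sub_rpow {p : ℝ} (hp : p < 1) (a b : ℝ) :
    IntegrableOn (fun τ : ℝ => |1 - τ| ^ (-p)) (Ioc a b) := by
  rcases le_total a b with hab | hab
  swap
  · simp [Ioc_eq_empty_of_le hab]
  have h1 : ∀ c : ℝ, IntervalIntegrable (fun x : ℝ => |x| ^ (-p)) volume 0 c := by
    intro c
    rcases le_total 0 c with hc | hc
    · refine (intervalIntegral.intervalIntegrable_rpow' (a := 0) (b := c)
        (by linarith : -1 < -p)).congr ?_
      intro x hx
      rw [uIoc_of_le hc] at hx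
      simp [abs_of_pos hx.1]
    · have := (intervalIntegral.intervalIntegrable_rpow' (a := 0) (b := -c)
        (by linarith : -1 < -p))
      have := IntervalIntegrable.comp_sub_left this 0
      simp only [zero_sub, neg_zero, neg_neg] at this
      refine this.congr ?_
      intro x hx
      rw [uIoc_of_ge hc] at hx
      simp [abs_of_nonpos hx.2]
  have h2 : IntervalIntegrable (fun x : ℝ => |x| ^ (-p)) volume (1 - a) (1 - b) :=
    (h1 _).symm.trans (h1 _)
  have h3 := h2.comp_sub_left 1
  simp only [sub_sub_cancel] at h3
  exact (intervalIntegrable_iff_integrableOn_Ioc_of_le hab).1 h3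

theorem integrableOn_domWeight {s p : ℝ} (hs' : s < 1) (hs : 0 < s) (hp : 0 ≤ p) (hp1 : p < 1)
    (hp2 : p < 2 * s) : IntegrableOn (domWeight s p) (Ioi 0) := by
  have hsplit : Ioi (0 : ℝ) = Ioc 0 (1 / 2) ∪ Ioi (1 / 2) :=
    (Ioc_union_Ioi_eq_Ioi (by norm_num)).symm
  rw [hsplit]
  refine IntegrableOn.union ?_ ?_
  · have h : IntegrableOn (fun τ : ℝ => τ ^ (1 - 2 * s)) (Ioc 0 (1 / 2)) :=
      (intervalIntegrable_iff_integrableOn_Ioc_of_le (by norm_num)).1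
        (intervalIntegral.intervalIntegrable_rpow' (by linarith))
    exact h.congr_fun (fun τ hτ => by simp only [domWeight]; rw [if_pos hτ.2]) measurableSet_Ioc
  · have htail : ∀ q : ℝ, q < 2 * s → ∀ a : ℝ, 0 < a →
        IntegrableOn (fun τ : ℝ => τ ^ q * τ ^ (-(1 + 2 * s))) (Ioi a) := by
      intro q hq a ha
      refine (integrableOn_Ioi_rpow_of_lt (a := q - (1 + 2 * s)) (by linarith) ha).congr_fun
        (fun τ hτ => ?_) measurableSet_Ioi
      have : 0 < τ := ha.trans hτ
      simp only [← Real.rpow_add this]; congr 1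
    have h1 : IntegrableOn (fun τ : ℝ => (1 + τ) ^ p * τ ^ (-(1 + 2 * s))) (Ioi (1 / 2)) := by
      refine ((htail p hp2 (1 / 2) (by norm_num)).const_mul (3 ^ p)).mono'
        (by fun_prop) ?_
      refine (ae_restrict_iff' measurableSet_Ioi).2 (.of_forall fun τ (hτ : 1 / 2 < τ) => ?_)
      have h0 : 0 < τ := by linarith
      rw [Real.norm_of_nonneg (by positivity), ← mul_assoc, ← Real.mul_rpow (by norm_num) h0.le]
      gcongr
      linarith
    have h2 : IntegrableOn (fun τ : ℝ => |1 - τ| ^ (-p) * τ ^ (-(1 + 2 * s))) (Ioi (1 / 2)) := by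
      rw [← Ioc_union_Ioi_eq_Ioi (show (1 / 2 : ℝ) ≤ 2 by norm_num)]
      refine IntegrableOn.union ?_ ?_
      · refine ((integrableOn_abs_one_sub_rpow hp1 (1 / 2) 2).const_mul
          ((1 / 2) ^ (-(1 + 2 * s)))).mono' (by fun_prop) ?_
        refine (ae_restrict_iff' measurableSet_Ioc).2 (.of_forall fun τ hτ => ?_)
        have h0 : 0 < τ := by linarith [hτ.1]
        rw [Real.norm_of_nonneg (by positivity), mul_comm]
        gcongr ?_ * _
        exact Real.rpow_le_rpow_of_nonpos (by norm_num) hτ.1.le (by linarith)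
      · refine (htail 0 (by linarith) 2 (by norm_num)).mono' (by fun_prop) ?_
        refine (ae_restrict_iff' measurableSet_Ioi).2 (.of_forall fun τ (hτ : 2 < τ) => ?_)
        have h0 : 0 < τ := by linarith
        rw [Real.norm_of_nonneg (by positivity), Real.rpow_zero]
        gcongr
        refine Real.rpow_le_one_of_one_le_of_nonpos ?_ (by linarith)
        rw [abs_of_neg (by linarith)]; linarith
    refine (h1.add h2).congr_fun (fun τ hτ => ?_) measurableSet_Ioi
    simp only [domWeight, Pi.add_apply]
    rw [if_neg (not_le.2 hτ)]; ring

theorem abs_exp_sub_one_sub_le (x : ℝ) : |Real.exp x - 1 - x| ≤ x ^ 2 * Real.exp |x| := by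
  have h := Complex.norm_exp_sub_sum_le_norm_mul_exp (x : ℂ) 2
  simp only [Finset.sum_range_succ, Finset.sum_range_zero] at h
  have e : Complex.exp x - (0 + (x : ℂ) ^ 0 / (Nat.factorial 0 : ℂ) + (x : ℂ) ^ 1 /
      (Nat.factorial 1 : ℂ)) = ((Real.exp x - 1 - x : ℝ) : ℂ) := by
    push_cast; simp; ring
  rw [e, Complex.norm_real, Complex.norm_real, Real.norm_eq_abs, Real.norm_eq_abs, sq_abs] at h
  exact h

theorem exp_mul_abs_log_le {p y : ℝ} (hy : 0 < y) :
    Real.exp (p * |Real.log y|) ≤ y ^ p + y ^ (-p) := by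
  rcases abs_cases (Real.log y) with ⟨h, -⟩ | ⟨h, -⟩
  · rw [h, mul_comm, ← Real.rpow_def_of_pos hy]
    linarith [Real.rpow_pos_of_pos hy (-p)]
  · rw [h, mul_neg, ← neg_mul, mul_comm, ← Real.rpow_def_of_pos hy]
    linarith [Real.rpow_pos_of_pos hy p]

theorem rpow_neg_remainder_le {p₀ p γ y : ℝ} (hp : p₀ < p) (hγ : |γ| ≤ p₀) (hy : 0 < y) :
    |y ^ (-γ) - 1 + γ * Real.log y| ≤ γ ^ 2 * (4 / (p - p₀) ^ 2 * (y ^ p + y ^ (-p))) := by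
  have h := abs_exp_sub_one_sub_le (-γ * Real.log y)
  rw [mul_comm (-γ), ← Real.rpow_def_of_pos hy] at h
  have e : y ^ (-γ) - 1 - Real.log y * -γ = y ^ (-γ) - 1 + γ * Real.log y := by ring
  rw [e] at h
  refine h.trans ?_
  set l := Real.log y
  have hε : 0 < p - p₀ := by linarith
  have h1 : l ^ 2 ≤ 4 / (p - p₀) ^ 2 * Real.exp ((p - p₀) * |l|) := by
    have h2 : (p - p₀) * |l| / 2 ≤ Real.exp ((p - p₀) * |l| / 2) := by
      linarith [Real.add_one_le_exp ((p - p₀) * |l| / 2)]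
    have h3 := pow_le_pow_left₀ (by positivity) h2 2
    rw [← Real.exp_nat_mul] at h3
    have e2 : ((2 : ℕ) : ℝ) * ((p - p₀) * |l| / 2) = (p - p₀) * |l| := by push_cast; ring
    rw [e2, div_pow, mul_pow, sq_abs] at h3
    rw [div_mul_eq_mul_div, le_div_iff₀ (by positivity)]
    linarith
  have h4 : Real.exp |l * -γ| ≤ Real.exp (p₀ * |l|) := by
    rw [abs_mul, abs_neg, mul_comm]; gcongr
  calc (l * -γ) ^ 2 * Real.exp |l * -γ|
      = γ ^ 2 * (l ^ 2 * Real.exp |l * -γ|) := by ring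
    _ ≤ γ ^ 2 * ((4 / (p - p₀) ^ 2 * Real.exp ((p - p₀) * |l|)) * Real.exp (p₀ * |l|)) := by
        gcongr
    _ = γ ^ 2 * (4 / (p - p₀) ^ 2 * Real.exp (p * |l|)) := by
        rw [mul_assoc (4 / _), ← Real.exp_add]; ring_nf
    _ ≤ _ := by
        gcongr
        exact exp_mul_abs_log_le hy

theorem abs_log_le_of_le_half {τ y : ℝ} (hτ : 0 < τ) (hτ' : τ ≤ 1 / 2) (h1 : 1 - τ ≤ y)
    (h2 : y ≤ 1 + τ) : |Real.log y| ≤ 2 * τ := by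
  have hy : 0 < y := by linarith
  rw [abs_le]
  constructor
  · have := Real.one_sub_inv_le_log_of_pos hy
    have h3 : y⁻¹ ≤ 1 + 2 * τ := by
      rw [inv_le_iff_one_le_mul₀ hy]; nlinarith
    linarith
  · linarith [Real.log_le_sub_one_of_pos hy]

/-- Each of the two distances contributes a remainder bounded by the weight, although the first
order terms are controlled only after symmetrization: near `τ = 0` the remainder is quadratic in
`log y`, hence already of order `τ ^ 2`. -/
theorem remainder_mul_le_domWeight {s p₀ p γ τ y : ℝ} (hp : p₀ < p) (hp1 : p < 1) (hγ : |γ| ≤ p₀)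
    (hτ : 0 < τ) (hτ1 : τ ≠ 1) (hy1 : |1 - τ| ≤ y) (hy2 : y ≤ 1 + τ) :
    |y ^ (-γ) - 1 + γ * Real.log y| * τ ^ (-(1 + 2 * s)) ≤
      γ ^ 2 * ((12 + 4 / (p - p₀) ^ 2) * domWeight s p τ) := by
  have h0 : 0 < |1 - τ| := abs_pos.2 (sub_ne_zero.2 hτ1.symm)
  have hy : 0 < y := h0.trans_le hy1
  have hp0 : 0 ≤ p := (abs_nonneg γ).trans (hγ.trans hp.le)
  have hc : 0 ≤ 4 / (p - p₀) ^ 2 := by positivity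
  unfold domWeight
  split_ifs with h
  · have hl := abs_log_le_of_le_half hτ h ((le_abs_self _).trans hy1) hy2
    have hK := abs_exp_sub_one_sub_le (-γ * Real.log y)
    rw [mul_comm (-γ), ← Real.rpow_def_of_pos hy] at hK
    have e : y ^ (-γ) - 1 - Real.log y * -γ = y ^ (-γ) - 1 + γ * Real.log y := by ring
    rw [e] at hK
    have hx : |Real.log y * -γ| ≤ 1 := by
      rw [abs_mul, abs_neg]
      nlinarith [abs_nonneg γ, abs_nonneg (Real.log y)]
    have hexp : Real.exp |Real.log y * -γ| ≤ 3 :=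
      (Real.exp_le_exp.2 hx).trans (by linarith [Real.exp_one_lt_d9])
    have hl2 : Real.log y ^ 2 ≤ 4 * τ ^ 2 := by
      rw [← sq_abs]; nlinarith [abs_nonneg (Real.log y)]
    have hw : τ ^ (1 - 2 * s) = τ ^ 2 * τ ^ (-(1 + 2 * s)) := by
      rw [← Real.rpow_natCast τ 2, ← Real.rpow_add hτ]; congr 1; push_cast; ring
    have hwp : 0 < τ ^ (-(1 + 2 * s)) := by positivity
    calc _ ≤ (Real.log y * -γ) ^ 2 * 3 * τ ^ (-(1 + 2 * s)) := by
            gcongr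
            exact hK.trans (by gcongr)
      _ = γ ^ 2 * (Real.log y ^ 2 * 3 * τ ^ (-(1 + 2 * s))) := by ring
      _ ≤ γ ^ 2 * (4 * τ ^ 2 * 3 * τ ^ (-(1 + 2 * s))) := by gcongr
      _ = γ ^ 2 * (12 * τ ^ (1 - 2 * s)) := by rw [hw]; ring
      _ ≤ _ := by
          gcongr
          linarith
  · have h1 := rpow_neg_remainder_le hp hγ hy
    have h2 : y ^ p ≤ (1 + τ) ^ p := by gcongr
    have h3 : y ^ (-p) ≤ |1 - τ| ^ (-p) := Real.rpow_le_rpow_of_nonpos h0 hy1 (by linarith)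
    calc _ ≤ γ ^ 2 * (4 / (p - p₀) ^ 2 * (y ^ p + y ^ (-p))) * τ ^ (-(1 + 2 * s)) := by gcongr
      _ = γ ^ 2 * (4 / (p - p₀) ^ 2 * ((y ^ p + y ^ (-p)) * τ ^ (-(1 + 2 * s)))) := by ring
      _ ≤ γ ^ 2 * ((12 + 4 / (p - p₀) ^ 2) *
            (((1 + τ) ^ p + |1 - τ| ^ (-p)) * τ ^ (-(1 + 2 * s)))) := by
          gcongr
          linarith

theorem abs_log_le_rpow_div {p y : ℝ} (hp : 0 < p) (hy : 0 < y) :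
    |Real.log y| ≤ 1 / p * (y ^ p + y ^ (-p)) := by
  have h := exp_mul_abs_log_le (p := p) hy
  have h2 := Real.add_one_le_exp (p * |Real.log y|)
  rw [div_mul_eq_mul_div, le_div_iff₀ hp]
  linarith

theorem log_add_log_mul_le_domWeight {s p τ y₁ y₂ : ℝ} (hp : 0 < p)
    (hτ : 0 < τ) (hτ1 : τ ≠ 1) (h₁ : |1 - τ| ≤ y₁) (h₁' : y₁ ≤ 1 + τ)
    (h₂ : |1 - τ| ≤ y₂) (h₂' : y₂ ≤ 1 + τ) (h : |1 - τ ^ 2| ≤ y₁ * y₂)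
    (h' : y₁ * y₂ ≤ 1 + τ ^ 2) :
    |Real.log y₁ + Real.log y₂| * τ ^ (-(1 + 2 * s)) ≤ (2 + 2 / p) * domWeight s p τ := by
  have h0 : 0 < |1 - τ| := abs_pos.2 (sub_ne_zero.2 hτ1.symm)
  have hy₁ : 0 < y₁ := h0.trans_le h₁
  have hy₂ : 0 < y₂ := h0.trans_le h₂
  unfold domWeight
  split_ifs with hc
  · have hl : |Real.log y₁ + Real.log y₂| ≤ 2 * τ ^ 2 := by
      rw [← Real.log_mul hy₁.ne' hy₂.ne']
      exact abs_log_le_of_le_half (by positivity) (by nlinarith)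
        ((le_abs_self _).trans h) h'
    have hw : τ ^ (1 - 2 * s) = τ ^ 2 * τ ^ (-(1 + 2 * s)) := by
      rw [← Real.rpow_natCast τ 2, ← Real.rpow_add hτ]; congr 1; push_cast; ring
    have : 0 ≤ 2 / p := by positivity
    calc _ ≤ 2 * τ ^ 2 * τ ^ (-(1 + 2 * s)) := by gcongr
      _ = 2 * τ ^ (1 - 2 * s) := by rw [hw]; ring
      _ ≤ _ := by gcongr; linarith
  · have key : ∀ y : ℝ, 0 < y → |1 - τ| ≤ y → y ≤ 1 + τ →
        |Real.log y| ≤ 1 / p * ((1 + τ) ^ p + |1 - τ| ^ (-p)) := by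
      intro y hy ha hb
      refine (abs_log_le_rpow_div hp hy).trans ?_
      have h3 : y ^ (-p) ≤ |1 - τ| ^ (-p) := Real.rpow_le_rpow_of_nonpos h0 ha (by linarith)
      gcongr
    have h4 := (abs_add_le (Real.log y₁) (Real.log y₂)).trans
      (add_le_add (key _ hy₁ h₁ h₁') (key _ hy₂ h₂ h₂'))
    rw [← mul_assoc]
    gcongr
    refine h4.trans ?_
    have : 0 ≤ (1 + τ) ^ p + |1 - τ| ^ (-p) := by positivity
    have e : 2 / p = 1 / p + 1 / p := by ring
    rw [e]; nlinarith

/-- The properties of the two distances `y₁ τ = ‖e + τ • ξ‖` and `y₂ τ = ‖e - τ • ξ‖` to the origin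
along a line through a unit vector `e` with unit direction `ξ` that are needed to expand the
operator. The bounds on `y₁ τ * y₂ τ` say that `log (y₁ τ) + log (y₂ τ)` is of second order at
`τ = 0`. -/
structure IsDistanceProfile (y₁ y₂ : ℝ → ℝ) : Prop where
  meas₁ : Measurable y₁
  meas₂ : Measurable y₂
  bounds₁ : ∀ τ, 0 < τ → |1 - τ| ≤ y₁ τ ∧ y₁ τ ≤ 1 + τ
  bounds₂ : ∀ τ, 0 < τ → |1 - τ| ≤ y₂ τ ∧ y₂ τ ≤ 1 + τ
  mul_bounds : ∀ τ, 0 < τ → |1 - τ ^ 2| ≤ y₁ τ * y₂ τ ∧ y₁ τ * y₂ τ ≤ 1 + τ ^ 2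

/-- The symmetrized integrand of the operator (without the factor `fracConst s`) applied to
`|x| ^ (-γ)`, along a line on which `|x|` is given by `y₁` forwards and by `y₂` backwards. -/
def profileIntegrand (s γ : ℝ) (y₁ y₂ : ℝ → ℝ) (τ : ℝ) : ℝ :=
  (y₁ τ ^ (-γ) + y₂ τ ^ (-γ) - 2) * τ ^ (-(1 + 2 * s))

/-- The symmetrized integrand of the operator (without the factor `fracConst s`) applied to
`log |x|`. Its negative is the derivative of `profileIntegrand s γ y₁ y₂` at `γ = 0`. -/
def logIntegrand (s : ℝ) (y₁ y₂ : ℝ → ℝ) (τ : ℝ) : ℝ :=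
  (Real.log (y₁ τ) + Real.log (y₂ τ)) * τ ^ (-(1 + 2 * s))

theorem ae_pos_ne_one : ∀ᵐ τ ∂(volume.restrict (Ioi (0 : ℝ))), 0 < τ ∧ τ ≠ 1 := by
  have h : ∀ᵐ τ : ℝ, τ ≠ 1 := by
    simp [ae_iff]
  filter_upwards [ae_restrict_mem measurableSet_Ioi, ae_restrict_of_ae h] with τ h1 h2
  exact ⟨h1, h2⟩

namespace IsDistanceProfile

variable {s p₀ p γ : ℝ} {y₁ y₂ : ℝ → ℝ}

theorem integrableOn_logIntegrand (hy : IsDistanceProfile y₁ y₂) (hs : 0 < s) (hs' : s < 1) :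
    IntegrableOn (logIntegrand s y₁ y₂) (Ioi 0) := by
  have m₁ := hy.meas₁
  have m₂ := hy.meas₂
  refine ((integrableOn_domWeight (p := s / 2) hs' hs (by linarith) (by linarith)
    (by linarith)).const_mul (2 + 2 / (s / 2))).mono' ?_ ?_
  · unfold logIntegrand; fun_prop
  · filter_upwards [ae_pos_ne_one] with τ hτ
    rw [logIntegrand, norm_mul, Real.norm_eq_abs, Real.norm_of_nonneg (Real.rpow_nonneg hτ.1.le _)]
    exact log_add_log_mul_le_domWeight (by linarith) hτ.1 hτ.2 (hy.bounds₁ τ hτ.1).1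
      (hy.bounds₁ τ hτ.1).2 (hy.bounds₂ τ hτ.1).1 (hy.bounds₂ τ hτ.1).2 (hy.mul_bounds τ hτ.1).1
      (hy.mul_bounds τ hτ.1).2

theorem norm_remainder_le (hy : IsDistanceProfile y₁ y₂) (hp : p₀ < p) (hp1 : p < 1)
    (hγ : |γ| ≤ p₀) {τ : ℝ} (hτ : 0 < τ) (hτ1 : τ ≠ 1) :
    ‖profileIntegrand s γ y₁ y₂ τ + γ * logIntegrand s y₁ y₂ τ‖ ≤
      γ ^ 2 * (2 * (12 + 4 / (p - p₀) ^ 2)) * domWeight s p τ := by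
  have h₁ := remainder_mul_le_domWeight (s := s) hp hp1 hγ hτ hτ1 (hy.bounds₁ τ hτ).1
    (hy.bounds₁ τ hτ).2
  have h₂ := remainder_mul_le_domWeight (s := s) hp hp1 hγ hτ hτ1 (hy.bounds₂ τ hτ).1
    (hy.bounds₂ τ hτ).2
  have e : profileIntegrand s γ y₁ y₂ τ + γ * logIntegrand s y₁ y₂ τ =
      ((y₁ τ ^ (-γ) - 1 + γ * Real.log (y₁ τ)) + (y₂ τ ^ (-γ) - 1 + γ * Real.log (y₂ τ))) *
        τ ^ (-(1 + 2 * s)) := by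
    unfold profileIntegrand logIntegrand; ring
  rw [e, norm_mul, Real.norm_eq_abs, Real.norm_of_nonneg (Real.rpow_nonneg hτ.le _)]
  have h3 := abs_add_le (y₁ τ ^ (-γ) - 1 + γ * Real.log (y₁ τ))
    (y₂ τ ^ (-γ) - 1 + γ * Real.log (y₂ τ))
  have h4 := mul_le_mul_of_nonneg_right h3 (Real.rpow_nonneg hτ.le (-(1 + 2 * s)))
  linarith

theorem integrableOn_remainder (hy : IsDistanceProfile y₁ y₂) (hs : 1 / 2 < s) (hs' : s < 1)
    (hγ : |γ| < 1) :
    IntegrableOn (fun τ => profileIntegrand s γ y₁ y₂ τ + γ * logIntegrand s y₁ y₂ τ)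
      (Ioi 0) := by
  have m₁ := hy.meas₁
  have m₂ := hy.meas₂
  obtain ⟨p, hp, hp1⟩ := exists_between hγ
  refine ((integrableOn_domWeight (s := s) (p := p) hs' (by linarith)
    ((abs_nonneg γ).trans hp.le) hp1 (by linarith)).const_mul
      (γ ^ 2 * (2 * (12 + 4 / (p - |γ|) ^ 2)))).mono' ?_ ?_
  · unfold logIntegrand profileIntegrand; fun_prop
  · filter_upwards [ae_pos_ne_one] with τ hτ
    exact hy.norm_remainder_le hp hp1 le_rfl hτ.1 hτ.2

theorem integrableOn_profileIntegrand (hy : IsDistanceProfile y₁ y₂) (hs : 1 / 2 < s)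
    (hs' : s < 1) (hγ : |γ| < 1) : IntegrableOn (profileIntegrand s γ y₁ y₂) (Ioi 0) := by
  have h := (hy.integrableOn_remainder hs hs' hγ).sub
    ((hy.integrableOn_logIntegrand (by linarith) hs').const_mul γ)
  refine h.congr (.of_forall fun τ => ?_)
  simp

/-- First order expansion at `γ = 0`, with a quadratic error, of the operator on `|x| ^ (-γ)`. -/
theorem exists_integral_le (hy : IsDistanceProfile y₁ y₂) (hs : 1 / 2 < s) (hs' : s < 1) :
    ∃ M : ℝ, ∀ γ : ℝ, |γ| ≤ 1 / 4 →
      ∫ τ in Ioi 0, profileIntegrand s γ y₁ y₂ τ ≤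
        -γ * (∫ τ in Ioi 0, logIntegrand s y₁ y₂ τ) + γ ^ 2 * M := by
  have hd := integrableOn_domWeight (s := s) (p := 1 / 2) hs' (by linarith) (by norm_num)
    (by norm_num) (by linarith)
  refine ⟨∫ τ in Ioi 0, (2 * (12 + 4 / (1 / 2 - 1 / 4 : ℝ) ^ 2)) * domWeight s (1 / 2) τ,
    fun γ hγ => ?_⟩
  have hγ1 : |γ| < 1 := by linarith
  have hl := hy.integrableOn_logIntegrand (s := s) (by linarith) hs'
  rw [← integral_const_mul, ← integral_const_mul, ← integral_add (hl.const_mul _)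
    ((hd.const_mul _).const_mul _)]
  refine integral_mono_ae (hy.integrableOn_profileIntegrand hs hs' hγ1)
    ((hl.const_mul _).add ((hd.const_mul _).const_mul _)) ?_
  filter_upwards [ae_pos_ne_one] with τ hτ
  have := (Real.le_norm_self _).trans (hy.norm_remainder_le (s := s) (p₀ := 1 / 4) (p := 1 / 2)
    (by norm_num) (by norm_num) hγ hτ.1 hτ.2)
  linarith

end IsDistanceProfile

/-! ### The two logarithmic integrals -/

theorem isDistanceProfile_radial : IsDistanceProfile (fun τ => 1 + τ) (fun τ => |1 - τ|) where
  meas₁ := by fun_prop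
  meas₂ := by fun_prop
  bounds₁ τ hτ := ⟨abs_le.2 ⟨by linarith, by linarith⟩, le_rfl⟩
  bounds₂ τ hτ := ⟨le_rfl, abs_le.2 ⟨by linarith, by linarith⟩⟩
  mul_bounds τ hτ := by
    have e : (1 + τ) * |1 - τ| = |1 - τ ^ 2| := by
      rw [← abs_of_pos (show 0 < 1 + τ by linarith), ← abs_mul]
      ring_nf
    rw [e]
    exact ⟨le_rfl, abs_le.2 ⟨by nlinarith, by nlinarith⟩⟩

theorem isDistanceProfile_perp :
    IsDistanceProfile (fun τ => √(1 + τ ^ 2)) (fun τ => √(1 + τ ^ 2)) := by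
  have h : ∀ τ : ℝ, 0 < τ → |1 - τ| ≤ √(1 + τ ^ 2) ∧ √(1 + τ ^ 2) ≤ 1 + τ := fun τ hτ =>
    ⟨Real.abs_le_sqrt (by nlinarith), Real.sqrt_le_iff.2 ⟨by linarith, by nlinarith⟩⟩
  refine ⟨by fun_prop, by fun_prop, h, h, fun τ hτ => ?_⟩
  rw [Real.mul_self_sqrt (by positivity)]
  exact ⟨abs_le.2 ⟨by nlinarith, by nlinarith⟩, le_rfl⟩

/-- The operator (without the factor `fracConst σ`) in the radial direction applied to `log |x|` at
a unit vector. -/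
def radialLog (σ : ℝ) : ℝ :=
  ∫ τ in Ioi 0, logIntegrand σ (fun τ => 1 + τ) (fun τ => |1 - τ|) τ

/-- The operator (without the factor `fracConst σ`) in a direction orthogonal to a unit vector,
applied to `log |x|` at that vector. -/
def perpLog (σ : ℝ) : ℝ :=
  ∫ τ in Ioi 0, logIntegrand σ (fun τ => √(1 + τ ^ 2)) (fun τ => √(1 + τ ^ 2)) τ

theorem hasDerivAt_mul_log_comp {τ : ℝ} (h₁ : 1 + τ ≠ 0) (h₂ : 1 - τ ≠ 0) :
    HasDerivAt (fun τ : ℝ => (1 + τ) * Real.log (1 + τ) + (1 - τ) * Real.log (1 - τ))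
      (Real.log (1 + τ) - Real.log (1 - τ)) τ := by
  have a₁ : HasDerivAt (fun τ : ℝ => 1 + τ) 1 τ := by
    simpa using (hasDerivAt_id τ).const_add 1
  have a₂ : HasDerivAt (fun τ : ℝ => 1 - τ) (-1) τ := by
    simpa using (hasDerivAt_id τ).const_sub 1
  have b₁ := (Real.hasDerivAt_mul_log h₁).comp τ a₁
  have b₂ := (Real.hasDerivAt_mul_log h₂).comp τ a₂
  refine (b₁.add b₂).congr_deriv ?_
  ring

/-- For `σ = 1 / 2` the integrand `log |1 - τ ^ 2| / τ ^ 2` has the primitive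
`-((1 + τ) * log (1 + τ) + (1 - τ) * log (1 - τ)) / τ`, which is continuous on `(0, ∞)` and vanishes
at both ends. -/
theorem radialLog_half : radialLog (1 / 2) = 0 := by
  have hint := isDistanceProfile_radial.integrableOn_logIntegrand (s := 1 / 2) (by norm_num)
    (by norm_num)
  unfold radialLog
  set f := logIntegrand (1 / 2) (fun τ => 1 + τ) (fun τ => |1 - τ|) with hf
  set H : ℝ → ℝ := fun τ => (1 + τ) * Real.log (1 + τ) + (1 - τ) * Real.log (1 - τ) with hH
  set G : ℝ → ℝ := fun τ => -(H τ / τ) with hG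
  have hHc : Continuous H :=
    (Real.continuous_mul_log.comp (continuous_const.add continuous_id)).add
      (Real.continuous_mul_log.comp (continuous_const.sub continuous_id))
  have hGd : ∀ τ, 0 < τ → τ ≠ 1 → HasDerivAt G (f τ) τ := by
    intro τ hτ hτ1
    have h := ((hasDerivAt_mul_log_comp (τ := τ) (by linarith)
      (sub_ne_zero.2 hτ1.symm)).div (hasDerivAt_id τ) hτ.ne').neg
    refine h.congr_deriv ?_
    have hp : τ ^ (-(1 + 2 * (1 / 2)) : ℝ) = (τ ^ 2)⁻¹ := by
      rw [Real.rpow_neg hτ.le]; norm_num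
    simp only [hf, logIntegrand, Real.log_abs, hp, id]
    field_simp
    ring
  have hGc : ContinuousAt G 1 := by
    refine (hHc.continuousAt.div continuousAt_id one_ne_zero).neg
  have hG0 : Tendsto G (𝓝[>] 0) (𝓝 0) := by
    have h := hasDerivAt_mul_log_comp (τ := 0) (by norm_num) (by norm_num)
    rw [hasDerivAt_iff_tendsto_slope] at h
    have h2 := (h.mono_left (nhdsWithin_mono 0
      (fun x (hx : 0 < x) => ne_of_gt hx : Ioi (0 : ℝ) ⊆ {0}ᶜ))).neg
    simp only [add_zero, sub_zero, Real.log_one, neg_zero] at h2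
    refine h2.congr fun τ => ?_
    simp [slope_def_field, hG, hH]
  have hGinf : Tendsto G atTop (𝓝 0) := by
    have t1 : Tendsto (fun τ : ℝ => Real.log (1 + τ) / (1 + τ)) atTop (𝓝 0) := by
      have := (Real.isLittleO_log_id_atTop.tendsto_div_nhds_zero).comp
        (tendsto_atTop_add_const_left atTop (1 : ℝ) tendsto_id)
      simpa [Function.comp_def] using this
    have t2 : Tendsto (fun τ : ℝ => Real.log (τ - 1) / (τ - 1)) atTop (𝓝 0) := by
      have := (Real.isLittleO_log_id_atTop.tendsto_div_nhds_zero).comp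
        (tendsto_atTop_add_const_right atTop (-1 : ℝ) tendsto_id)
      simpa [Function.comp_def, sub_eq_add_neg] using this
    have tinv : Tendsto (fun τ : ℝ => τ⁻¹) atTop (𝓝 0) := tendsto_inv_atTop_zero
    have r1 : Tendsto (fun τ : ℝ => 1 + τ⁻¹) atTop (𝓝 1) := by simpa using tinv.const_add 1
    have r2 : Tendsto (fun τ : ℝ => 1 - τ⁻¹) atTop (𝓝 1) := by simpa using tinv.const_sub 1
    have t3 : Tendsto (fun τ : ℝ => Real.log ((1 + τ⁻¹) / (1 - τ⁻¹))) atTop (𝓝 0) := by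
      have := (r1.div r2 one_ne_zero).log (by norm_num)
      simpa using this
    have t4 := (((t1.mul r1).add (t2.mul r2)).add t3).neg
    simp only [zero_mul, add_zero, neg_zero] at t4
    refine t4.congr' ?_
    filter_upwards [eventually_gt_atTop (1 : ℝ)] with τ hτ
    have h0 : τ ≠ 0 := by linarith
    have h1 : 0 < τ - 1 := by linarith
    have h2 : 0 < 1 + τ := by linarith
    have e : (1 + τ⁻¹) / (1 - τ⁻¹) = (1 + τ) / (τ - 1) := by
      have : 1 - τ⁻¹ = (τ - 1) / τ := by field_simp
      rw [this]; field_simp; ring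
    have e2 : Real.log (1 - τ) = Real.log (τ - 1) := by
      rw [← Real.log_neg_eq_log, neg_sub]
    rw [e, Real.log_div h2.ne' h1.ne']
    simp only [hG, hH, e2]
    field_simp
    ring
  have hsub1 : IntegrableOn f (Ioc 0 1) := hint.mono_set (fun x hx => hx.1)
  have hsub2 : IntegrableOn f (Ioi 1) := hint.mono_set (fun x (hx : 1 < x) => by
    simp only [mem_Ioi]; linarith)
  have i1 : ∫ τ in Ioc 0 1, f τ = G 1 - 0 := by
    rw [← intervalIntegral.integral_of_le zero_le_one]
    exact intervalIntegral.integral_eq_sub_of_hasDerivAt_of_tendsto one_pos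
      (fun τ hτ => hGd τ hτ.1 hτ.2.ne)
      ((intervalIntegrable_iff_integrableOn_Ioc_of_le zero_le_one).2 hsub1) hG0
      (hGc.tendsto.mono_left nhdsWithin_le_nhds)
  have i2 : ∫ τ in Ioi 1, f τ = 0 - G 1 :=
    integral_Ioi_of_hasDerivAt_of_tendsto hGc.continuousWithinAt
      (fun τ (hτ : 1 < τ) => hGd τ (by linarith) hτ.ne') hsub2 hGinf
  rw [← Ioc_union_Ioi_eq_Ioi (zero_le_one' ℝ), setIntegral_union (Ioc_disjoint_Ioi le_rfl)
    measurableSet_Ioi hsub1 hsub2, i1, i2]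
  ring

theorem log_add_log_abs_sign {τ : ℝ} (hτ : 0 < τ) (hτ1 : τ ≠ 1) :
    (√2 < τ → 0 < Real.log (1 + τ) + Real.log |1 - τ|) ∧
      (τ < √2 → Real.log (1 + τ) + Real.log |1 - τ| < 0) := by
  have h0 : 0 < |1 - τ| := abs_pos.2 (sub_ne_zero.2 hτ1.symm)
  have e : Real.log (1 + τ) + Real.log |1 - τ| = Real.log |1 - τ ^ 2| := by
    rw [← Real.log_mul (by linarith) h0.ne', ← abs_of_pos (show 0 < 1 + τ by linarith), ← abs_mul]
    ring_nf
  rw [e]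
  constructor
  · intro h
    have h2 : 2 < τ ^ 2 := (Real.sqrt_lt' hτ).1 h
    refine Real.log_pos ?_
    rw [abs_of_neg (by linarith)]; linarith
  · intro h
    have h2 : τ ^ 2 < 2 := (Real.lt_sqrt hτ.le).1 h
    have h3 : 1 - τ ^ 2 ≠ 0 := by
      intro h; apply hτ1; nlinarith
    exact Real.log_neg (abs_pos.2 h3) (abs_lt.2 ⟨by linarith, by nlinarith⟩)

/-- `log |1 - τ ^ 2|` changes sign exactly where the monotone factor `τ ^ (1 - 2 * σ)` crosses the
value `√2 ^ (1 - 2 * σ)`, so that replacing the factor by this value changes the integrand in one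
direction only. -/
theorem logIntegrand_radial_comparison {σ τ : ℝ} (hτ : 0 < τ) (hτ1 : τ ≠ 1) (hτ2 : τ ≠ √2) :
    (1 / 2 < σ → logIntegrand σ (fun τ => 1 + τ) (fun τ => |1 - τ|) τ <
      √2 ^ (1 - 2 * σ) * logIntegrand (1 / 2) (fun τ => 1 + τ) (fun τ => |1 - τ|) τ) ∧
    (σ < 1 / 2 → √2 ^ (1 - 2 * σ) * logIntegrand (1 / 2) (fun τ => 1 + τ) (fun τ => |1 - τ|) τ <
      logIntegrand σ (fun τ => 1 + τ) (fun τ => |1 - τ|) τ) := by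
  have e : τ ^ (-(1 + 2 * σ)) = τ ^ (1 - 2 * σ) * τ ^ (-(1 + 2 * (1 / 2)) : ℝ) := by
    rw [← Real.rpow_add hτ]; congr 1; ring
  have hw : 0 < τ ^ (-(1 + 2 * (1 / 2)) : ℝ) := by positivity
  have h2 : (0 : ℝ) < √2 := by positivity
  obtain ⟨ha, hb⟩ := log_add_log_abs_sign hτ hτ1
  simp only [logIntegrand, e]
  set l := Real.log (1 + τ) + Real.log |1 - τ|
  set W := τ ^ (-(1 + 2 * (1 / 2)) : ℝ)
  have e3 : ∀ A B : ℝ, l * (A * W) - B * (l * W) = l * (A - B) * W := fun A B => by ring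
  rcases lt_or_gt_of_ne hτ2 with h | h
  · refine ⟨fun hσ => ?_, fun hσ => ?_⟩
    · have := Real.rpow_lt_rpow_of_neg hτ h (by linarith : 1 - 2 * σ < 0)
      have h3 := mul_neg_of_neg_of_pos (mul_neg_of_neg_of_pos (hb h) (sub_pos.2 this)) hw
      linarith [e3 (τ ^ (1 - 2 * σ)) (√2 ^ (1 - 2 * σ))]
    · have := Real.rpow_lt_rpow hτ.le h (by linarith : 0 < 1 - 2 * σ)
      have h3 := mul_pos (mul_pos_of_neg_of_neg (hb h) (sub_neg.2 this)) hw
      linarith [e3 (τ ^ (1 - 2 * σ)) (√2 ^ (1 - 2 * σ))]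
  · refine ⟨fun hσ => ?_, fun hσ => ?_⟩
    · have := Real.rpow_lt_rpow_of_neg h2 h (by linarith : 1 - 2 * σ < 0)
      have h3 := mul_neg_of_neg_of_pos (mul_neg_of_pos_of_neg (ha h) (sub_neg.2 this)) hw
      linarith [e3 (τ ^ (1 - 2 * σ)) (√2 ^ (1 - 2 * σ))]
    · have := Real.rpow_lt_rpow h2.le h (by linarith : 0 < 1 - 2 * σ)
      have h3 := mul_pos (mul_pos (ha h) (sub_pos.2 this)) hw
      linarith [e3 (τ ^ (1 - 2 * σ)) (√2 ^ (1 - 2 * σ))]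

theorem integral_lt_integral_of_ae_lt {f g : ℝ → ℝ} (hf : IntegrableOn f (Ioi 0))
    (hg : IntegrableOn g (Ioi 0)) (h : ∀ᵐ τ ∂(volume.restrict (Ioi (0 : ℝ))), f τ < g τ) :
    ∫ τ in Ioi 0, f τ < ∫ τ in Ioi 0, g τ := by
  have hnn : 0 ≤ᵐ[volume.restrict (Ioi (0 : ℝ))] g - f := by
    filter_upwards [h] with τ hτ using sub_nonneg.2 hτ.le
  refine lt_of_le_of_ne (integral_mono_ae hf hg (h.mono fun _ => le_of_lt)) fun heq => ?_
  have h0 : ∫ τ in Ioi 0, (g - f) τ = 0 := by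
    simp only [Pi.sub_apply]
    rw [integral_sub hg hf, heq, sub_self]
  rw [integral_eq_zero_iff_of_nonneg_ae hnn (hg.sub hf)] at h0
  have hF : ∀ᵐ _ ∂(volume.restrict (Ioi (0 : ℝ))), False := by
    filter_upwards [h, h0] with τ h1 h2
    simp only [Pi.sub_apply, Pi.zero_apply] at h2
    linarith
  rw [eventually_false_iff_eq_bot, ae_eq_bot, Measure.restrict_eq_zero, Real.volume_Ioi] at hF
  exact ENNReal.top_ne_zero hF

theorem radialLog_neg {σ : ℝ} (h : 1 / 2 < σ) (h' : σ < 1) : radialLog σ < 0 := by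
  have i₁ := isDistanceProfile_radial.integrableOn_logIntegrand (s := σ) (by linarith) h'
  have i₂ := (isDistanceProfile_radial.integrableOn_logIntegrand (s := 1 / 2) (by norm_num)
    (by norm_num)).const_mul (√2 ^ (1 - 2 * σ))
  have h2 : ∀ᵐ τ : ℝ, τ ≠ √2 := by simp [ae_iff]
  have := integral_lt_integral_of_ae_lt i₁ i₂ (by
    filter_upwards [ae_pos_ne_one, ae_restrict_of_ae h2] with τ h3 h4
    exact (logIntegrand_radial_comparison h3.1 h3.2 h4).1 h)
  rwa [integral_const_mul, ← radialLog, ← radialLog, radialLog_half, mul_zero] at this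

theorem radialLog_pos {σ : ℝ} (h : 0 < σ) (h' : σ < 1 / 2) : 0 < radialLog σ := by
  have i₁ := isDistanceProfile_radial.integrableOn_logIntegrand (s := σ) (by linarith)
    (by linarith)
  have i₂ := (isDistanceProfile_radial.integrableOn_logIntegrand (s := 1 / 2) (by norm_num)
    (by norm_num)).const_mul (√2 ^ (1 - 2 * σ))
  have h2 : ∀ᵐ τ : ℝ, τ ≠ √2 := by simp [ae_iff]
  have := integral_lt_integral_of_ae_lt i₂ i₁ (by
    filter_upwards [ae_pos_ne_one, ae_restrict_of_ae h2] with τ h3 h4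
    exact (logIntegrand_radial_comparison h3.1 h3.2 h4).2 h')
  rwa [integral_const_mul, ← radialLog, ← radialLog, radialLog_half, mul_zero] at this

theorem perpLog_nonneg (σ : ℝ) : 0 ≤ perpLog σ := by
  refine setIntegral_nonneg measurableSet_Ioi fun τ (hτ : 0 < τ) => ?_
  have : 0 ≤ Real.log √(1 + τ ^ 2) :=
    Real.log_nonneg (Real.one_le_sqrt.2 (by nlinarith [sq_nonneg τ]))
  unfold logIntegrand
  positivity

/-- The sum of the two integrands is `log |1 - τ ^ 4| * τ ^ (-(1 + 2 * s))`, and the substitution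
`t = τ ^ 2` turns it into the radial integrand with `s / 2` in place of `s`. -/
theorem radialLog_add_perpLog {s : ℝ} (hs : 0 < s) (hs' : s < 1) :
    radialLog s + perpLog s = radialLog (s / 2) / 2 := by
  have i₁ := isDistanceProfile_radial.integrableOn_logIntegrand hs hs'
  have i₂ := isDistanceProfile_perp.integrableOn_logIntegrand hs hs'
  have key := integral_comp_rpow_Ioi_of_pos
    (g := logIntegrand (s / 2) (fun τ => 1 + τ) (fun τ => |1 - τ|)) (p := 2) two_pos
  rw [radialLog, perpLog, ← integral_add i₁ i₂, radialLog, ← key, eq_div_iff two_ne_zero,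
    ← integral_mul_const]
  refine integral_congr_ae ?_
  filter_upwards [ae_pos_ne_one] with τ hτ
  obtain ⟨hτ, hτ1⟩ := hτ
  have h0 : 0 < |1 - τ| := abs_pos.2 (sub_ne_zero.2 hτ1.symm)
  have h1 : 0 < 1 + τ := by linarith
  have h2 : 0 < 1 + τ ^ 2 := by positivity
  have e : |1 - τ ^ 2| = (1 + τ) * |1 - τ| := by
    rw [← abs_of_pos h1, ← abs_mul]; ring_nf
  have ew : τ ^ (-(1 + 2 * s)) = τ ^ (2 - 1 : ℝ) * (τ ^ (2 : ℝ)) ^ (-(1 + 2 * (s / 2))) := by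
    rw [← Real.rpow_mul hτ.le, ← Real.rpow_add hτ]; congr 1; ring
  simp only [logIntegrand, smul_eq_mul, ew, Real.rpow_two, e, Real.log_mul h1.ne' h0.ne',
    Real.log_sqrt h2.le]
  ring

theorem radialLog_add_mul_perpLog_pos {s : ℝ} (hs : 0 < s) (hs' : s < 1) {k : ℕ} (hk : 2 ≤ k) :
    0 < radialLog s + ((k : ℝ) - 1) * perpLog s := by
  have h := radialLog_pos (σ := s / 2) (by linarith) (by linarith)
  have h2 := radialLog_add_perpLog hs hs'
  have h3 := perpLog_nonneg s
  have h4 : (2 : ℝ) ≤ k := by exact_mod_cast hk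
  nlinarith

/-! ### The coefficients of the operator on powers -/

theorem fracConst_pos {s : ℝ} (hs : 0 < s) (hs' : s < 1) : 0 < fracConst s := by
  unfold fracConst
  have h1 := Real.Gamma_pos_of_pos (show 0 < 1 / 2 + s by linarith)
  have h2 := Real.Gamma_pos_of_pos (show 0 < 1 - s by linarith)
  have h3 := Real.sqrt_pos.2 Real.pi_pos
  positivity

theorem cRadial_eq (s γ : ℝ) : cRadial s γ =
    fracConst s * ∫ τ in Ioi 0, profileIntegrand s γ (fun τ => 1 + τ) (fun τ => |1 - τ|) τ := by
  unfold cRadial pvIntegral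
  congr 1
  refine setIntegral_congr_fun measurableSet_Ioi fun τ (hτ : 0 < τ) => ?_
  have h1 : |1 + τ| = 1 + τ := abs_of_pos (by linarith)
  simp only [profileIntegrand, abs_neg, abs_of_pos hτ, h1, ← sub_eq_add_neg]
  ring

theorem cPerp_eq (s γ : ℝ) : cPerp s γ = fracConst s *
    ∫ τ in Ioi 0, profileIntegrand s γ (fun τ => √(1 + τ ^ 2)) (fun τ => √(1 + τ ^ 2)) τ := by
  unfold cPerp
  rw [mul_comm 2 (fracConst s), mul_assoc, ← integral_const_mul]
  congr 1
  refine setIntegral_congr_fun measurableSet_Ioi fun τ (hτ : 0 < τ) => ?_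
  have h : √(1 + τ ^ 2) ^ (-γ) = (1 + τ ^ 2) ^ (-γ / 2) := by
    rw [Real.sqrt_eq_rpow, ← Real.rpow_mul (by positivity)]; ring_nf
  simp only [profileIntegrand, h]
  ring

theorem exists_pos_lt_quadratic_neg {A : ℝ} (hA : 0 < A) (M : ℝ) {ε : ℝ} (hε : 0 < ε) :
    ∃ t, 0 < t ∧ t < ε ∧ -t * A + t ^ 2 * M < 0 := by
  refine ⟨min (ε / 2) (A / (2 * (|M| + 1))), by positivity, (min_le_left _ _).trans_lt
    (by linarith), ?_⟩
  set t := min (ε / 2) (A / (2 * (|M| + 1))) with ht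
  have ht0 : 0 < t := by positivity
  have h1 : t * (2 * (|M| + 1)) ≤ A := (le_div_iff₀ (by positivity)).1 (min_le_right _ _)
  have h2 : t * M ≤ t * |M| := by gcongr; exact le_abs_self M
  nlinarith

/-- The operator in the radial direction is negative on `|x| ^ b` for small `b > 0`, because it is
negative on `log |x|`. -/
theorem exists_cRadial_neg {s : ℝ} (hs : 1 / 2 < s) (hs' : s < 1) :
    ∃ b, 0 < b ∧ b < 1 ∧ cRadial s (-b) < 0 := by
  obtain ⟨M, hM⟩ := isDistanceProfile_radial.exists_integral_le hs hs'
  obtain ⟨b, hb, hb', h⟩ := exists_pos_lt_quadratic_neg (neg_pos.2 (radialLog_neg hs hs')) M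
    (show (0 : ℝ) < 1 / 4 by norm_num)
  refine ⟨b, hb, by linarith, ?_⟩
  rw [cRadial_eq]
  refine mul_neg_of_pos_of_neg (fracConst_pos (by linarith) hs') ?_
  have := hM (-b) (by rw [abs_neg, abs_of_pos hb]; exact hb'.le)
  rw [← radialLog] at this
  linarith [this, neg_sq b]

/-- `cExtremal s k` vanishes at `0` with a negative derivative there. -/
theorem exists_cExtremal_neg {s : ℝ} (hs : 1 / 2 < s) (hs' : s < 1) {k : ℕ} (hk : 2 ≤ k) {ε : ℝ}
    (hε : 0 < ε) : ∃ γ, 0 < γ ∧ γ < ε ∧ cExtremal s k γ < 0 := by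
  obtain ⟨M, hM⟩ := isDistanceProfile_radial.exists_integral_le hs hs'
  obtain ⟨M', hM'⟩ := isDistanceProfile_perp.exists_integral_le hs hs'
  obtain ⟨γ, hγ, hγ', h⟩ := exists_pos_lt_quadratic_neg
    (radialLog_add_mul_perpLog_pos (s := s) (by linarith) hs' hk) (M + ((k : ℝ) - 1) * M')
    (lt_min hε (show (0 : ℝ) < 1 / 4 by norm_num))
  refine ⟨γ, hγ, hγ'.trans_le (min_le_left _ _), ?_⟩
  have hk1 : (0 : ℝ) ≤ (k : ℝ) - 1 := by
    have : (2 : ℝ) ≤ k := by exact_mod_cast hk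
    linarith
  have habs : |γ| ≤ 1 / 4 := by
    rw [abs_of_pos hγ]; exact (hγ'.trans_le (min_le_right _ _)).le
  have h1 := hM γ habs
  have h2 := mul_le_mul_of_nonneg_left (hM' γ habs) hk1
  rw [← radialLog] at h1
  rw [← perpLog] at h2
  rw [cExtremal, cRadial_eq, cPerp_eq, mul_left_comm, ← mul_add]
  refine mul_neg_of_pos_of_neg (fracConst_pos (by linarith) hs') ?_
  linarith

theorem rpow_neg_remainder_nonneg {y : ℝ} (hy : 0 < y) (γ : ℝ) :
    0 ≤ y ^ (-γ) - 1 + γ * Real.log y := by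
  rw [Real.rpow_def_of_pos hy]
  linarith [Real.add_one_le_exp (Real.log y * -γ)]

theorem IsDistanceProfile.pos {y₁ y₂ : ℝ → ℝ} (hy : IsDistanceProfile y₁ y₂) {τ : ℝ} (hτ : 0 < τ)
    (hτ1 : τ ≠ 1) : 0 < y₁ τ ∧ 0 < y₂ τ := by
  have h0 : 0 < |1 - τ| := abs_pos.2 (sub_ne_zero.2 hτ1.symm)
  exact ⟨h0.trans_le (hy.bounds₁ τ hτ).1, h0.trans_le (hy.bounds₂ τ hτ).1⟩

theorem IsDistanceProfile.remainder_nonneg {s : ℝ} {y₁ y₂ : ℝ → ℝ} (hy : IsDistanceProfile y₁ y₂)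
    (γ : ℝ) {τ : ℝ} (hτ : 0 < τ) (hτ1 : τ ≠ 1) :
    0 ≤ profileIntegrand s γ y₁ y₂ τ + γ * logIntegrand s y₁ y₂ τ := by
  have h₁ := rpow_neg_remainder_nonneg (hy.pos hτ hτ1).1 γ
  have h₂ := rpow_neg_remainder_nonneg (hy.pos hτ hτ1).2 γ
  have e : profileIntegrand s γ y₁ y₂ τ + γ * logIntegrand s y₁ y₂ τ =
      ((y₁ τ ^ (-γ) - 1 + γ * Real.log (y₁ τ)) + (y₂ τ ^ (-γ) - 1 + γ * Real.log (y₂ τ))) *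
        τ ^ (-(1 + 2 * s)) := by
    unfold profileIntegrand logIntegrand; ring
  rw [e]
  positivity

theorem integral_one_sub_rpow {γ : ℝ} (hγ : γ < 1) :
    ∫ τ in Ioc (1 / 2 : ℝ) 1, |1 - τ| ^ (-γ) = (1 / 2) ^ (1 - γ) / (1 - γ) := by
  rw [← intervalIntegral.integral_of_le (by norm_num),
    intervalIntegral.integral_comp_sub_left (fun x => |x| ^ (-γ)) 1, sub_self]
  have : ∫ x in (0 : ℝ)..(1 - 1 / 2), |x| ^ (-γ) = ∫ x in (0 : ℝ)..(1 - 1 / 2), x ^ (-γ) := by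
    refine intervalIntegral.integral_congr fun x hx => ?_
    rw [uIcc_of_le (by norm_num)] at hx
    simp only [abs_of_nonneg hx.1]
  rw [this, integral_rpow (Or.inl (by linarith)), Real.zero_rpow (by linarith)]
  norm_num
  ring_nf

/-- The singularity `|1 - τ| ^ (-γ)` makes the radial coefficient blow up as `γ → 1`. -/
theorem integral_radial_remainder_ge {s γ : ℝ} (hs : 1 / 2 < s) (hs' : s < 1) (hγ : 0 < γ)
    (hγ' : γ < 1) : 1 / (2 * (1 - γ)) - 4 ≤
      ∫ τ in Ioi 0, (profileIntegrand s γ (fun τ => 1 + τ) (fun τ => |1 - τ|) τ +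
        γ * logIntegrand s (fun τ => 1 + τ) (fun τ => |1 - τ|) τ) := by
  have hint := isDistanceProfile_radial.integrableOn_remainder (s := s) (γ := γ) hs hs'
    (by rwa [abs_of_pos hγ])
  have hsub : Ioc (1 / 2 : ℝ) 1 ⊆ Ioi 0 := fun τ hτ => by
    simp only [mem_Ioi]; linarith [hτ.1]
  have i₁ := integrableOn_abs_one_sub_rpow hγ' (1 / 2) 1
  have i₂ := integrableOn_abs_one_sub_rpow (show γ / 2 < 1 by linarith) (1 / 2) 1
  have h1 : 1 / (2 * (1 - γ)) ≤ (1 / 2 : ℝ) ^ (1 - γ) / (1 - γ) := by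
    rw [← div_div]
    have : (1 / 2 : ℝ) ^ (1 : ℝ) ≤ (1 / 2 : ℝ) ^ (1 - γ) :=
      Real.rpow_le_rpow_of_exponent_ge (by norm_num) (by norm_num) (by linarith)
    rw [Real.rpow_one] at this
    have : 0 < 1 - γ := by linarith
    gcongr
  have h2 : (1 / 2 : ℝ) ^ (1 - γ / 2) / (1 - γ / 2) ≤ 2 := by
    rw [div_le_iff₀ (by linarith)]
    have : (1 / 2 : ℝ) ^ (1 - γ / 2) ≤ 1 :=
      Real.rpow_le_one (by norm_num) (by norm_num) (by linarith)
    linarith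
  have hne : ∀ᵐ τ : ℝ, τ ≠ 1 := by simp [ae_iff]
  calc 1 / (2 * (1 - γ)) - 4
      ≤ (1 / 2 : ℝ) ^ (1 - γ) / (1 - γ) - 2 * ((1 / 2 : ℝ) ^ (1 - γ / 2) / (1 - γ / 2)) := by
        linarith
    _ = ∫ τ in Ioc (1 / 2 : ℝ) 1, (|1 - τ| ^ (-γ) - 2 * |1 - τ| ^ (-(γ / 2))) := by
        rw [integral_sub i₁ (i₂.const_mul 2), integral_const_mul, integral_one_sub_rpow hγ',
          integral_one_sub_rpow (by linarith)]
    _ ≤ ∫ τ in Ioc (1 / 2 : ℝ) 1,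
          (profileIntegrand s γ (fun τ => 1 + τ) (fun τ => |1 - τ|) τ +
            γ * logIntegrand s (fun τ => 1 + τ) (fun τ => |1 - τ|) τ) := by
        refine integral_mono_ae (i₁.sub (i₂.const_mul 2)) (hint.mono_set hsub) ?_
        filter_upwards [ae_restrict_mem measurableSet_Ioc, ae_restrict_of_ae hne] with τ hτ hτ1
        have hτ0 : 0 < τ := hsub hτ
        obtain ⟨hy₁, hy₂⟩ := isDistanceProfile_radial.pos hτ0 hτ1
        have hr₁ := rpow_neg_remainder_nonneg hy₁ γ
        have hr₂ := rpow_neg_remainder_nonneg hy₂ γ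
        have hw : 1 ≤ τ ^ (-(1 + 2 * s)) :=
          Real.one_le_rpow_of_pos_of_le_one_of_nonpos hτ0 hτ.2 (by linarith)
        have hx : 0 ≤ Real.log |1 - τ| * -(γ / 2) := by
          have : Real.log |1 - τ| ≤ 0 := Real.log_nonpos hy₂.le
            (abs_le.2 ⟨by linarith [hτ.2], by linarith⟩)
          nlinarith
        -- for `x ≥ 0`, `1 + x ≤ 2 * exp (x / 2)`, applied to `x = -γ * log |1 - τ|`
        have hexp : 1 - γ * Real.log |1 - τ| ≤ 2 * |1 - τ| ^ (-(γ / 2)) := by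
          rw [Real.rpow_def_of_pos hy₂]
          linarith [Real.add_one_le_exp (Real.log |1 - τ| * -(γ / 2))]
        simp only [profileIntegrand, logIntegrand]
        nlinarith
    _ ≤ _ := by
        refine setIntegral_mono_set hint ?_ hsub.eventuallyLE
        filter_upwards [ae_pos_ne_one] with τ hτ
        exact isDistanceProfile_radial.remainder_nonneg γ hτ.1 hτ.2

theorem exists_cExtremal_pos {s : ℝ} (hs : 1 / 2 < s) (hs' : s < 1) {k : ℕ} (hk : 2 ≤ k) :
    ∃ γ, 0 < γ ∧ γ < 1 ∧ 0 < cExtremal s k γ := by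
  have hk1 : (0 : ℝ) ≤ (k : ℝ) - 1 := by
    have : (2 : ℝ) ≤ k := by exact_mod_cast hk
    linarith
  set K : ℝ := |radialLog s| + ((k : ℝ) - 1) * perpLog s + 5 with hK
  have hK0 : 0 < K := by have := perpLog_nonneg s; positivity
  -- the exponent is chosen so that `1 / (2 * (1 - γ)) = K + 1`
  have hγ0 : (0 : ℝ) < 1 / (2 * (K + 1)) := by positivity
  have hγ1 : 1 / (2 * (K + 1)) < (1 : ℝ) := by
    rw [div_lt_one (by positivity)]; linarith
  refine ⟨1 - 1 / (2 * (K + 1)), by linarith, by linarith, ?_⟩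
  set γ := 1 - 1 / (2 * (K + 1)) with hγ
  have g0 : 0 < γ := by linarith
  have g1 : γ < 1 := by linarith
  have gabs : |γ| < 1 := by rwa [abs_of_pos g0]
  have hge := integral_radial_remainder_ge hs hs' g0 g1
  have e1 : 1 / (2 * (1 - γ)) = K + 1 := by
    rw [hγ]; field_simp; ring
  have lin : ∀ {y₁ y₂ : ℝ → ℝ}, IsDistanceProfile y₁ y₂ →
      ∫ τ in Ioi 0, (profileIntegrand s γ y₁ y₂ τ + γ * logIntegrand s y₁ y₂ τ) =
        (∫ τ in Ioi 0, profileIntegrand s γ y₁ y₂ τ) +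
          γ * ∫ τ in Ioi 0, logIntegrand s y₁ y₂ τ := fun hy => by
    rw [integral_add (hy.integrableOn_profileIntegrand hs hs' gabs)
      ((hy.integrableOn_logIntegrand (by linarith) hs').const_mul γ), integral_const_mul]
  have hperp : 0 ≤ ∫ τ in Ioi 0,
      (profileIntegrand s γ (fun τ => √(1 + τ ^ 2)) (fun τ => √(1 + τ ^ 2)) τ +
        γ * logIntegrand s (fun τ => √(1 + τ ^ 2)) (fun τ => √(1 + τ ^ 2)) τ) := by
    refine integral_nonneg_of_ae ?_
    filter_upwards [ae_pos_ne_one] with τ hτ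
    exact isDistanceProfile_perp.remainder_nonneg γ hτ.1 hτ.2
  rw [lin isDistanceProfile_radial, e1, ← radialLog] at hge
  rw [lin isDistanceProfile_perp, ← perpLog] at hperp
  rw [cExtremal, cRadial_eq, cPerp_eq, mul_left_comm, ← mul_add]
  refine mul_pos (fracConst_pos (by linarith) hs') ?_
  have h1 : γ * radialLog s ≤ |radialLog s| := by
    have := le_abs_self (γ * radialLog s)
    rw [abs_mul, abs_of_pos g0] at this
    nlinarith [abs_nonneg (radialLog s)]
  have h2 : γ * perpLog s ≤ perpLog s := by nlinarith [perpLog_nonneg s]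
  nlinarith

theorem IsDistanceProfile.convexOn {s : ℝ} {y₁ y₂ : ℝ → ℝ} (hy : IsDistanceProfile y₁ y₂)
    (hs : 1 / 2 < s) (hs' : s < 1) :
    ConvexOn ℝ (Ioo 0 1) (fun γ => ∫ τ in Ioi 0, profileIntegrand s γ y₁ y₂ τ) := by
  have hint : ∀ γ ∈ Ioo (0 : ℝ) 1, IntegrableOn (profileIntegrand s γ y₁ y₂) (Ioi 0) :=
    fun γ hγ => hy.integrableOn_profileIntegrand hs hs' (by rw [abs_of_pos hγ.1]; exact hγ.2)
  refine ⟨convex_Ioo 0 1, fun γ hγ δ hδ a b ha hb hab => ?_⟩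
  have hc := convex_Ioo (0 : ℝ) 1 hγ hδ ha hb hab
  have key : ∀ y : ℝ, 0 < y → y ^ (-(a * γ + b * δ)) ≤ a * y ^ (-γ) + b * y ^ (-δ) := by
    intro y hy
    have := (convexOn_rpow_left hy).2 (mem_univ (-γ)) (mem_univ (-δ)) ha hb hab
    simp only [smul_eq_mul] at this
    refine le_trans (le_of_eq ?_) this
    ring_nf
  simp only [smul_eq_mul] at hc ⊢
  rw [← integral_const_mul, ← integral_const_mul,
    ← integral_add ((hint γ hγ).const_mul a) ((hint δ hδ).const_mul b)]
  refine integral_mono_ae (hint _ hc) (((hint γ hγ).const_mul a).add ((hint δ hδ).const_mul b)) ?_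
  filter_upwards [ae_pos_ne_one] with τ hτ
  have h₁ := key _ (hy.pos hτ.1 hτ.2).1
  have h₂ := key _ (hy.pos hτ.1 hτ.2).2
  have hw : 0 ≤ τ ^ (-(1 + 2 * s)) := Real.rpow_nonneg hτ.1.le _
  have e : a * ((y₁ τ ^ (-γ) + y₂ τ ^ (-γ) - 2) * τ ^ (-(1 + 2 * s))) +
      b * ((y₁ τ ^ (-δ) + y₂ τ ^ (-δ) - 2) * τ ^ (-(1 + 2 * s))) =
      ((a * y₁ τ ^ (-γ) + b * y₁ τ ^ (-δ)) + (a * y₂ τ ^ (-γ) + b * y₂ τ ^ (-δ)) - 2 * (a + b)) *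
        τ ^ (-(1 + 2 * s)) := by ring
  simp only [profileIntegrand, e, hab]
  gcongr
  linarith

theorem convexOn_cExtremal {s : ℝ} (hs : 1 / 2 < s) (hs' : s < 1) {k : ℕ} (hk : 2 ≤ k) :
    ConvexOn ℝ (Ioo 0 1) (cExtremal s k) := by
  have hk1 : (0 : ℝ) ≤ (k : ℝ) - 1 := by
    have : (2 : ℝ) ≤ k := by exact_mod_cast hk
    linarith
  have hC := (fracConst_pos (by linarith : 0 < s) hs').le
  have h := ((isDistanceProfile_radial.convexOn hs hs').smul hC).add
    (((isDistanceProfile_perp.convexOn hs hs').smul hC).smul hk1)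
  refine h.congr fun γ _ => ?_
  simp only [cExtremal, cRadial_eq, cPerp_eq, Pi.add_apply, smul_eq_mul]

theorem exists_unique_zero_cExtremal {s : ℝ} (hs : 1 / 2 < s) (hs' : s < 1) {k : ℕ} (hk : 2 ≤ k) :
    ∃ γbar, (0 < γbar ∧ γbar < 1 ∧ cExtremal s k γbar = 0) ∧
      (∀ γ, 0 < γ → γ < 1 → cExtremal s k γ = 0 → γ = γbar) ∧
      ∀ γ, 0 < γ → γ < γbar → cExtremal s k γ < 0 := by
  have hconv := convexOn_cExtremal hs hs' hk
  have hcont : ContinuousOn (cExtremal s k) (Ioo 0 1) := hconv.continuousOn isOpen_Ioo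
  -- convexity propagates a negative value near `0` up to the next zero
  have hneg : ∀ γ δ, 0 < γ → γ < δ → δ < 1 → cExtremal s k δ = 0 → cExtremal s k γ < 0 := by
    intro γ δ h0 hγδ h1 hδ
    obtain ⟨ε, hε, hεγ, hεneg⟩ := exists_cExtremal_neg hs hs' hk h0
    have hpos : 0 < δ - ε := by linarith
    have ha : 0 ≤ (δ - γ) / (δ - ε) := div_nonneg (by linarith) hpos.le
    have hb : 0 ≤ (γ - ε) / (δ - ε) := div_nonneg (by linarith) hpos.le
    have hε1 : ε ∈ Ioo (0 : ℝ) 1 := ⟨hε, by linarith⟩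
    have hδ1 : δ ∈ Ioo (0 : ℝ) 1 := ⟨by linarith, h1⟩
    have h := hconv.2 hε1 hδ1 ha hb (by field_simp; ring)
    have e : ((δ - γ) / (δ - ε)) • ε + ((γ - ε) / (δ - ε)) • δ = γ := by
      simp only [smul_eq_mul]; field_simp; ring
    rw [e, hδ, smul_zero, add_zero, smul_eq_mul] at h
    exact h.trans_lt (mul_neg_of_pos_of_neg (div_pos (by linarith) hpos) hεneg)
  obtain ⟨γ₁, h₁, h₁', hpos⟩ := exists_cExtremal_pos hs hs' hk
  obtain ⟨γ₀, h₀, h₀', hn⟩ := exists_cExtremal_neg hs hs' hk h₁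
  obtain ⟨γbar, hmem, hz⟩ := intermediate_value_Icc h₀'.le
    (hcont.mono (Icc_subset_Ioo h₀ h₁')) (show (0 : ℝ) ∈ Icc _ _ from ⟨hn.le, hpos.le⟩)
  have hb0 : 0 < γbar := h₀.trans_le hmem.1
  have hb1 : γbar < 1 := hmem.2.trans_lt h₁'
  refine ⟨γbar, ⟨hb0, hb1, hz⟩, fun γ g0 g1 gz => ?_, fun γ g0 g1 => hneg γ γbar g0 g1 hb1 hz⟩
  rcases lt_trichotomy γ γbar with h | h | h
  · exact absurd gz (hneg γ γbar g0 h hb1 hz).ne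
  · exact h
  · exact absurd hz (hneg γbar γ hb0 h g1 gz).ne

/-! ### Extended integrals and the operator along a line -/

theorem extIntegral_mono_ae {S : Set ℝ} {f g : ℝ → ℝ}
    (h : ∀ᵐ τ ∂(volume.restrict S), f τ ≤ g τ) : extIntegral S f ≤ extIntegral S g := by
  refine EReal.sub_le_sub ?_ ?_ <;> refine EReal.coe_ennreal_le_coe_ennreal_iff.2 ?_ <;>
    refine lintegral_mono_ae ?_ <;> filter_upwards [h] with τ hτ
  · exact ENNReal.ofReal_le_ofReal hτ
  · exact ENNReal.ofReal_le_ofReal (neg_le_neg hτ)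

theorem extIntegral_eq_integral {S : Set ℝ} {f : ℝ → ℝ} (h : IntegrableOn f S) :
    extIntegral S f = ((∫ τ in S, f τ : ℝ) : EReal) := by
  have h1 : (∫⁻ τ in S, ENNReal.ofReal (f τ)) ≠ ⊤ := (Integrable.lintegral_lt_top h).ne
  have h2 : (∫⁻ τ in S, ENNReal.ofReal (-(f τ))) ≠ ⊤ := (Integrable.lintegral_lt_top h.neg).ne
  rw [integral_eq_lintegral_pos_part_sub_lintegral_neg_part h, EReal.coe_sub,
    EReal.coe_ennreal_toReal h1, EReal.coe_ennreal_toReal h2, extIntegral]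

theorem compl_Ioo_neg_eq (δ : ℝ) : (Ioo (-δ) δ)ᶜ = Iic (-δ) ∪ Ici δ := by
  ext τ
  simp only [mem_compl_iff, mem_Ioo, mem_union, mem_Iic, mem_Ici, not_and_or, not_lt]

/-- For an integrable symmetrization, the splitting at `δ` into a principal value and a tail is
immaterial, and no infinite values occur. -/
theorem pvExtIntegral_add_extIntegral {Q : ℝ → ℝ} {δ : ℝ} (hδ : 0 < δ)
    (hP : IntegrableOn (fun τ => Q τ + Q (-τ)) (Ioi 0)) (hQ : IntegrableOn Q (Ioo (-δ) δ)ᶜ) :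
    pvExtIntegral δ Q + extIntegral (Ioo (-δ) δ)ᶜ Q =
      ((∫ τ in Ioi 0, (Q τ + Q (-τ)) : ℝ) : EReal) := by
  have hs1 : Ioo 0 δ ⊆ Ioi 0 := fun τ hτ => hτ.1
  have hs2 : Ici δ ⊆ Ioi 0 := fun τ (hτ : δ ≤ τ) => hδ.trans_le hτ
  have hQ1 : IntegrableOn Q (Iic (-δ)) := hQ.mono_set (by
    rw [compl_Ioo_neg_eq δ]; exact subset_union_left)
  have hQ2 : IntegrableOn Q (Ici δ) := hQ.mono_set (by
    rw [compl_Ioo_neg_eq δ]; exact subset_union_right)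
  have hdisj : Disjoint (Iic (-δ)) (Ici δ) := by
    rw [Set.disjoint_left]; intro τ h1 h2
    simp only [mem_Iic, mem_Ici] at h1 h2; linarith
  have hQ3 : IntegrableOn (fun τ => Q (-τ)) (Ici δ) := by
    have := (hP.mono_set hs2).sub hQ2
    refine this.congr (.of_forall fun τ => ?_)
    simp
  rw [pvExtIntegral, extIntegral_eq_integral (hP.mono_set hs1), extIntegral_eq_integral hQ,
    ← EReal.coe_add]
  congr 1
  rw [compl_Ioo_neg_eq δ, setIntegral_union hdisj measurableSet_Ici hQ1 hQ2,
    ← integral_comp_neg_Ioi, ← integral_Ici_eq_integral_Ioi, add_comm (∫ τ in Ici δ, Q (-τ)),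
    ← integral_add hQ2 hQ3, ← Ioo_union_Ici_eq_Ioi hδ,
    setIntegral_union _ measurableSet_Ici (hP.mono_set hs1) (hP.mono_set hs2)]
  rw [Set.disjoint_left]; intro τ h1 h2
  exact absurd h1.2 (not_lt.2 h2)

/-- Away from the origin, integrability of the symmetrization passes to the function itself, since
the lower bound prevents cancellation between `Q τ` and `Q (-τ)`. -/
theorem integrableOn_compl_Ioo {Q : ℝ → ℝ} {δ c w : ℝ} (hδ : 0 < δ) (hw : 1 < w)
    (hm : Measurable Q) (hlow : ∀ τ, -(c * |τ| ^ (-w)) ≤ Q τ)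
    (hP : IntegrableOn (fun τ => Q τ + Q (-τ)) (Ioi 0)) : IntegrableOn Q (Ioo (-δ) δ)ᶜ := by
  have hs2 : Ici δ ⊆ Ioi 0 := fun τ (hτ : δ ≤ τ) => hδ.trans_le hτ
  have hi : IntegrableOn (fun τ : ℝ => c * |τ| ^ (-w)) (Ici δ) := by
    rw [integrableOn_Ici_iff_integrableOn_Ioi]
    have h : IntegrableOn (fun τ : ℝ => c * τ ^ (-w)) (Ioi δ) :=
      (integrableOn_Ioi_rpow_of_lt (by linarith) hδ).const_mul c
    refine h.congr_fun (fun τ (hτ : δ < τ) => ?_) measurableSet_Ioi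
    simp only [abs_of_pos (hδ.trans hτ)]
  have key : ∀ R : ℝ → ℝ, Measurable R → (∀ τ, -(c * |τ| ^ (-w)) ≤ R τ) →
      (∀ τ, R τ + R (-τ) = Q τ + Q (-τ)) → IntegrableOn R (Ici δ) := by
    intro R hR hRlow hRs
    have h1 : IntegrableOn (fun τ => R τ + c * |τ| ^ (-w)) (Ici δ) := by
      refine ((hP.mono_set hs2).add (hi.add hi)).mono' (by fun_prop) (.of_forall fun τ => ?_)
      have h1 := hRlow τ
      have h2 := hRlow (-τ)
      rw [abs_neg] at h2
      rw [Real.norm_of_nonneg (by linarith)]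
      simp only [Pi.add_apply, ← hRs]
      linarith
    refine (h1.sub hi).congr (.of_forall fun τ => ?_)
    simp
  rw [compl_Ioo_neg_eq δ]
  refine IntegrableOn.union ?_ (key Q hm hlow fun τ => rfl)
  have h := key (fun τ => Q (-τ)) (by fun_prop) (fun τ => by simpa using hlow (-τ))
    (fun τ => by simp only [neg_neg]; ring)
  have := h.comp_neg
  simpa using this

variable {N : ℕ}

/-- The lower bound on the product of the distances is the Cauchy-Schwarz inequality for `e + τ • ξ`
and `e - τ • ξ`, the upper one the parallelogram law. -/
theorem isDistanceProfile_norm {e ξ : EuclideanSpace ℝ (Fin N)} (he : ‖e‖ = 1) (hξ : ‖ξ‖ = 1) :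
    IsDistanceProfile (fun τ => ‖e + τ • ξ‖) (fun τ => ‖e - τ • ξ‖) := by
  have hn : ∀ τ : ℝ, 0 < τ → ‖τ • ξ‖ = τ := fun τ hτ => by
    rw [norm_smul, hξ, mul_one, Real.norm_of_nonneg hτ.le]
  refine ⟨by fun_prop, by fun_prop, fun τ hτ => ⟨?_, ?_⟩, fun τ hτ => ⟨?_, ?_⟩,
    fun τ hτ => ⟨?_, ?_⟩⟩
  · have := abs_norm_sub_norm_le e (-(τ • ξ))
    rwa [norm_neg, hn τ hτ, he, sub_neg_eq_add] at this
  · have := norm_add_le e (τ • ξ)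
    rwa [hn τ hτ, he] at this
  · have := abs_norm_sub_norm_le e (τ • ξ)
    rwa [hn τ hτ, he] at this
  · have := norm_sub_le e (τ • ξ)
    rwa [hn τ hτ, he] at this
  · have h := abs_real_inner_le_norm (e + τ • ξ) (e - τ • ξ)
    have e1 : inner ℝ (e + τ • ξ) (e - τ • ξ) = 1 - τ ^ 2 := by
      rw [inner_add_left, inner_sub_right, inner_sub_right, real_inner_self_eq_norm_sq,
        real_inner_self_eq_norm_sq, hn τ hτ, he, real_inner_comm]
      ring
    rwa [e1] at h
  · have h := parallelogram_law_with_norm ℝ e (τ • ξ)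
    rw [hn τ hτ, he] at h
    nlinarith [sq_nonneg (‖e + τ • ξ‖ - ‖e - τ • ξ‖)]

theorem lineIntegrand_rpow_scaling {s γ R : ℝ} (hR : 0 < R) (e ξ : EuclideanSpace ℝ (Fin N))
    (he : ‖e‖ = 1) {τ : ℝ} (hτ : 0 < τ) :
    lineIntegrand s (fun x => ‖x‖ ^ (-γ)) (R • e) ξ (R * τ) +
      lineIntegrand s (fun x => ‖x‖ ^ (-γ)) (R • e) ξ (-(R * τ)) =
    fracConst s * R ^ (-γ - (1 + 2 * s)) *
      profileIntegrand s γ (fun τ => ‖e + τ • ξ‖) (fun τ => ‖e - τ • ξ‖) τ := by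
  have h1 : R • e + (R * τ) • ξ = R • (e + τ • ξ) := by rw [smul_add, smul_smul]
  have h2 : R • e + (-(R * τ)) • ξ = R • (e - τ • ξ) := by
    rw [smul_sub, smul_smul, neg_smul, sub_eq_add_neg]
  have hn : ∀ y : EuclideanSpace ℝ (Fin N), ‖R • y‖ ^ (-γ) = R ^ (-γ) * ‖y‖ ^ (-γ) := fun y => by
    rw [norm_smul, Real.norm_of_nonneg hR.le, Real.mul_rpow hR.le (norm_nonneg _)]
  have hRt : 0 < R * τ := by positivity
  simp only [lineIntegrand, h1, h2, hn, he, Real.one_rpow, abs_neg, abs_of_pos hRt,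
    Real.mul_rpow hR.le hτ.le, profileIntegrand, sub_eq_add_neg (-γ), Real.rpow_add hR]
  ring

/-- The operator in the direction `ξ` applied to `|x| ^ (-γ)` at the point `R • e`: by homogeneity it
is `R ^ (-γ - 2 * s)` times its value at the unit vector `e`. The exponent `γ` may be negative. -/
theorem integral_lineIntegrand_rpow {s γ : ℝ} (hs : 1 / 2 < s) (hs' : s < 1) (hγ : |γ| < 1)
    {e ξ : EuclideanSpace ℝ (Fin N)} (he : ‖e‖ = 1) (hξ : ‖ξ‖ = 1) {R δ : ℝ} (hR : 0 < R)
    (hδ : 0 < δ) {Q : ℝ → ℝ} (hQ : Q = lineIntegrand s (fun x => ‖x‖ ^ (-γ)) (R • e) ξ) :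
    IntegrableOn (fun τ => Q τ + Q (-τ)) (Ioi 0) ∧ IntegrableOn Q (Ioo (-δ) δ)ᶜ ∧
      ∫ τ in Ioi 0, (Q τ + Q (-τ)) = R ^ (-γ - 2 * s) * (fracConst s *
        ∫ τ in Ioi 0, profileIntegrand s γ (fun τ => ‖e + τ • ξ‖) (fun τ => ‖e - τ • ξ‖) τ) := by
  have hC := fracConst_pos (by linarith : 0 < s) hs'
  have hprof := (isDistanceProfile_norm he hξ).integrableOn_profileIntegrand hs hs' hγ
  have hscale : ∀ τ ∈ Ioi (0 : ℝ), Q (R * τ) + Q (-(R * τ)) =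
      fracConst s * R ^ (-γ - (1 + 2 * s)) *
        profileIntegrand s γ (fun τ => ‖e + τ • ξ‖) (fun τ => ‖e - τ • ξ‖) τ := fun τ hτ => by
    rw [hQ]; exact lineIntegrand_rpow_scaling hR e ξ he hτ
  have hP : IntegrableOn (fun τ => Q τ + Q (-τ)) (Ioi 0) := by
    have := (integrableOn_Ioi_comp_mul_left_iff (fun τ => Q τ + Q (-τ)) 0 hR).1
      (IntegrableOn.congr_fun (Integrable.const_mul hprof _) (fun τ hτ => (hscale τ hτ).symm) measurableSet_Ioi)
    rwa [mul_zero] at this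
  refine ⟨hP, ?_, ?_⟩
  · refine integrableOn_compl_Ioo (c := fracConst s * R ^ (-γ)) (w := 1 + 2 * s) hδ
      (by linarith) ?_ (fun τ => ?_) hP
    · rw [hQ]; unfold lineIntegrand; fun_prop
    · rw [hQ, lineIntegrand, mul_assoc, ← mul_neg, ← neg_mul]
      have hRe : ‖R • e‖ = R := by rw [norm_smul, he, mul_one, Real.norm_of_nonneg hR.le]
      simp only [hRe]
      gcongr
      have : 0 ≤ ‖R • e + τ • ξ‖ ^ (-γ) := by positivity
      linarith
  · have h := integral_comp_mul_left_Ioi (fun τ => Q τ + Q (-τ)) 0 hR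
    rw [mul_zero, setIntegral_congr_fun measurableSet_Ioi hscale, integral_const_mul,
      smul_eq_mul, eq_inv_mul_iff_mul_eq₀ hR.ne'] at h
    have e1 : R ^ (-γ - 2 * s) = R * R ^ (-γ - (1 + 2 * s)) := by
      nth_rewrite 2 [← Real.rpow_one R]
      rw [← Real.rpow_add hR]; congr 1; ring
    rw [← h, e1]; ring

/-! ### Bounded below supersolutions for `k = 1` are constant -/

theorem lineIntegrand_rpow_sub {s β ε : ℝ} (z x ξ : EuclideanSpace ℝ (Fin N)) :
    lineIntegrand s (fun y => -ε * ‖y - z‖ ^ β) x ξ =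
      fun τ => -ε * lineIntegrand s (fun y => ‖y‖ ^ (-(-β))) (x - z) ξ τ := by
  funext τ
  simp only [lineIntegrand, neg_neg, add_sub_right_comm]
  ring

/-- Away from `z`, the function `-ε * ‖y - z‖ ^ b` is smooth and a strict subsolution in the radial
direction, so it cannot touch a supersolution from below. -/
theorem not_isMinOn_add_rpow_norm {s b ε : ℝ} (hs : 1 / 2 < s) (hs' : s < 1) (hb : 0 < b)
    (hb1 : b < 1) (hc : cRadial s (-b) < 0) (hε : 0 < ε) {u : EuclideanSpace ℝ (Fin N) → ℝ}
    (hu : IsViscositySupersolution s 1 u) {z x : EuclideanSpace ℝ (Fin N)} (hxz : x ≠ z) :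
    ¬ ∀ y, u x + ε * ‖x - z‖ ^ b ≤ u y + ε * ‖y - z‖ ^ b := by
  intro hmin
  set φ : EuclideanSpace ℝ (Fin N) → ℝ := fun y => -ε * ‖y - z‖ ^ b with hφ
  have hle : ∀ y, φ y - φ x ≤ u y - u x := fun y => by
    have := hmin y
    simp only [hφ]
    linarith
  set R := ‖x - z‖ with hR
  have hR0 : 0 < R := norm_pos_iff.2 (sub_ne_zero.2 hxz)
  set e := R⁻¹ • (x - z) with he
  have hRe : R • e = x - z := by rw [he, smul_smul, mul_inv_cancel₀ hR0.ne', one_smul]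
  have hen : ‖e‖ = 1 := by
    rw [he, norm_smul, ← hR, norm_inv, Real.norm_of_nonneg hR0.le, inv_mul_cancel₀ hR0.ne']
  have hφd : ContDiffOn ℝ 2 φ (Metric.ball x R) := by
    intro y hy
    have hyz : y - z ≠ 0 := by
      intro h
      rw [sub_eq_zero] at h
      rw [h, Metric.mem_ball, dist_comm, dist_eq_norm] at hy
      exact lt_irrefl _ hy
    refine ContDiffAt.contDiffWithinAt ?_
    exact contDiffAt_const.mul (((contDiffAt_id.sub contDiffAt_const).norm ℝ hyz).rpow_const_of_ne
      (norm_ne_zero_iff.2 hyz))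
  have hsuper := hu.2 x R φ hR0 hφd (fun y _ => by
    have := hle y
    simp only [mem_ofPred_eq]
    linarith)
  have hframe : Orthonormal ℝ (fun _ : Fin 1 => e) :=
    ⟨fun _ => hen, fun i j hij => (hij (Subsingleton.elim i j)).elim⟩
  have hterm := (le_iSup (fun ξ : {ξ : Fin 1 → EuclideanSpace ℝ (Fin N) // Orthonormal ℝ ξ} =>
    ∑ i, (pvExtIntegral R (lineIntegrand s φ x (ξ.1 i)) +
      extIntegral (Ioo (-R) R)ᶜ (lineIntegrand s u x (ξ.1 i)))) ⟨_, hframe⟩).trans hsuper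
  simp only [Finset.univ_unique, Finset.sum_singleton] at hterm
  obtain ⟨h1, h2, h3⟩ := integral_lineIntegrand_rpow (γ := -b) hs hs'
    (by rwa [abs_neg, abs_of_pos hb]) hen hen hR0 hR0 rfl
  rw [hRe] at h1 h2 h3
  have hφl : lineIntegrand s φ x e = _ := lineIntegrand_rpow_sub (s := s) (ε := ε) (β := b) z x e
  have hmono : extIntegral (Ioo (-R) R)ᶜ (lineIntegrand s φ x e) ≤
      extIntegral (Ioo (-R) R)ᶜ (lineIntegrand s u x e) := by
    refine extIntegral_mono_ae (.of_forall fun τ => ?_)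
    have := hle (x + τ • e)
    have hC := fracConst_pos (by linarith : 0 < s) hs'
    unfold lineIntegrand
    gcongr
  have hval := (add_le_add_right hmono (pvExtIntegral R (lineIntegrand s φ x e))).trans hterm
  rw [hφl, pvExtIntegral_add_extIntegral hR0 ?_ (h2.const_mul _)] at hval
  swap
  · refine (Integrable.const_mul h1 (-ε)).congr (.of_forall fun τ => ?_)
    simp only; ring
  have hrad : ∫ τ in Ioi 0, profileIntegrand s (-b) (fun τ => ‖e + τ • e‖) (fun τ => ‖e - τ • e‖) τ
      = ∫ τ in Ioi 0, profileIntegrand s (-b) (fun τ => 1 + τ) (fun τ => |1 - τ|) τ := by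
    refine setIntegral_congr_fun measurableSet_Ioi fun τ (hτ : 0 < τ) => ?_
    have e1 : ‖e + τ • e‖ = 1 + τ := by
      nth_rewrite 1 [← one_smul ℝ e]
      rw [← add_smul, norm_smul, hen, mul_one, Real.norm_of_nonneg (by linarith)]
    have e2 : ‖e - τ • e‖ = |1 - τ| := by
      nth_rewrite 1 [← one_smul ℝ e]
      rw [← sub_smul, norm_smul, hen, mul_one, Real.norm_eq_abs]
    simp only [profileIntegrand, e1, e2]
  simp only [← mul_add] at hval
  rw [integral_const_mul, h3, hrad, ← cRadial_eq] at hval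
  -- the radial direction alone already makes the supremum positive
  have hpos : 0 < -ε * (R ^ (-(-b) - 2 * s) * cRadial s (-b)) := by
    have : 0 < R ^ (-(-b) - 2 * s) := by positivity
    nlinarith [mul_neg_of_pos_of_neg this hc]
  exact absurd hval (not_le.2 (by exact_mod_cast hpos))

theorem exists_forall_add_rpow_norm_le {b ε : ℝ} (hb : 0 < b) (hε : 0 < ε)
    {u : EuclideanSpace ℝ (Fin N) → ℝ} (hu : LowerSemicontinuous u) (hbdd : BddBelow (range u))
    (z : EuclideanSpace ℝ (Fin N)) :
    ∃ x, ∀ y, u x + ε * ‖x - z‖ ^ b ≤ u y + ε * ‖y - z‖ ^ b := by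
  obtain ⟨m, hm⟩ := hbdd
  have hm' : ∀ y, m ≤ u y := fun y => hm (mem_range_self y)
  -- outside the ball of radius `ρ` the term `ε * ‖y - z‖ ^ b` exceeds `u z - m`
  set ρ := ((u z - m) / ε) ^ (1 / b) with hρ
  have hz : 0 ≤ (u z - m) / ε := div_nonneg (by linarith [hm' z]) hε.le
  have hρ0 : 0 ≤ ρ := Real.rpow_nonneg hz _
  have hρb : ε * ρ ^ b = u z - m := by
    rw [hρ, ← Real.rpow_mul hz, one_div_mul_cancel hb.ne', Real.rpow_one]
    field_simp
  have hc : Continuous fun y : EuclideanSpace ℝ (Fin N) => ε * ‖y - z‖ ^ b :=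
    continuous_const.mul ((continuous_id.sub continuous_const).norm.rpow_const
      fun _ => Or.inr hb.le)
  have hlsc : LowerSemicontinuous fun y => u y + ε * ‖y - z‖ ^ b :=
    hu.add hc.lowerSemicontinuous
  obtain ⟨x, -, hx⟩ := (hlsc.lowerSemicontinuousOn _).exists_isMinOn
    ⟨z, Metric.mem_closedBall_self hρ0⟩ (isCompact_closedBall z ρ)
  refine ⟨x, fun y => ?_⟩
  by_cases hy : y ∈ Metric.closedBall z ρ
  · exact hx hy
  · have h1 : u x + ε * ‖x - z‖ ^ b ≤ u z + ε * ‖z - z‖ ^ b :=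
      hx (Metric.mem_closedBall_self hρ0)
    rw [sub_self, norm_zero, Real.zero_rpow hb.ne', mul_zero, add_zero] at h1
    rw [Metric.mem_closedBall, not_le, dist_eq_norm] at hy
    have h2 : ρ ^ b ≤ ‖y - z‖ ^ b := by gcongr
    nlinarith [hm' y]

theorem eq_const_of_isViscositySupersolution_one {s : ℝ} (hs : 1 / 2 < s) (hs' : s < 1)
    {u : EuclideanSpace ℝ (Fin N) → ℝ} (hu : IsViscositySupersolution s 1 u)
    (hbdd : BddBelow (range u)) : ∃ c : ℝ, ∀ x, u x = c := by
  obtain ⟨b, hb, hb1, hc⟩ := exists_cRadial_neg hs hs'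
  have key : ∀ z y, u z ≤ u y := by
    intro z y
    have h : ∀ ε : ℝ, 0 < ε → u z ≤ u y + ε * ‖y - z‖ ^ b := by
      intro ε hε
      obtain ⟨x, hx⟩ := exists_forall_add_rpow_norm_le hb hε hu.1 hbdd z
      have hxz : x = z := by
        by_contra hne
        exact not_isMinOn_add_rpow_norm hs hs' hb hb1 hc hε hu hne hx
      subst hxz
      have := hx y
      rwa [sub_self, norm_zero, Real.zero_rpow hb.ne', mul_zero, add_zero] at this
    have hlim : Tendsto (fun ε : ℝ => u y + ε * ‖y - z‖ ^ b) (𝓝[>] 0) (𝓝 (u y + 0 * ‖y - z‖ ^ b)) :=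
      (((continuous_id.mul continuous_const).const_add (u y)).tendsto 0).mono_left
        nhdsWithin_le_nhds
    rw [zero_mul, add_zero] at hlim
    exact ge_of_tendsto hlim (by filter_upwards [self_mem_nhdsWithin] with ε hε using h ε hε)
  exact ⟨u 0, fun x => le_antisymm (key _ _) (key _ _)⟩

/-! ### The operator in an arbitrary direction -/

theorem rpow_neg_convex {r x y a b : ℝ} (hr : 0 < r) (hx : 0 < x) (hy : 0 < y) (ha : 0 ≤ a)
    (hb : 0 ≤ b) (hab : a + b = 1) :
    (a * x + b * y) ^ (-r) ≤ a * x ^ (-r) + b * y ^ (-r) := by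
  have h1 := Real.geom_mean_le_arith_mean2_weighted ha hb hx.le hy.le hab
  have h2 := Real.geom_mean_le_arith_mean2_weighted ha hb (Real.rpow_nonneg hx.le (-r))
    (Real.rpow_nonneg hy.le (-r)) hab
  have h3 : (a * x + b * y) ^ (-r) ≤ (x ^ a * y ^ b) ^ (-r) :=
    Real.rpow_le_rpow_of_nonpos (by positivity) h1 (by linarith)
  refine h3.trans (le_of_eq_of_le ?_ h2)
  rw [Real.mul_rpow (by positivity) (by positivity), ← Real.rpow_mul hx.le, ← Real.rpow_mul hy.le,
    ← Real.rpow_mul hx.le, ← Real.rpow_mul hy.le, mul_comm a, mul_comm b]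

/-- Monotonicity in `z` of the even function `(B - z) ^ (-r) + (B + z) ^ (-r)`, by convexity of
`x ^ (-r)`: the points `B ± a * z` are convex combinations of `B ± z`. -/
theorem rpow_neg_symm_add_le {r B a z : ℝ} (hr : 0 < r) (hz : 0 ≤ z) (hzB : z < B) (ha : 0 ≤ a)
    (ha1 : a ≤ 1) :
    (B - a * z) ^ (-r) + (B + a * z) ^ (-r) ≤ (B - z) ^ (-r) + (B + z) ^ (-r) := by
  have h1 := rpow_neg_convex hr (show 0 < B - z by linarith) (show 0 < B + z by linarith)
    (show 0 ≤ (1 + a) / 2 by linarith) (show 0 ≤ (1 - a) / 2 by linarith) (by ring)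
  have h2 := rpow_neg_convex hr (show 0 < B - z by linarith) (show 0 < B + z by linarith)
    (show 0 ≤ (1 - a) / 2 by linarith) (show 0 ≤ (1 + a) / 2 by linarith) (by ring)
  rw [show (1 + a) / 2 * (B - z) + (1 - a) / 2 * (B + z) = B - a * z by ring] at h1
  rw [show (1 - a) / 2 * (B - z) + (1 + a) / 2 * (B + z) = B + a * z by ring] at h2
  linarith

theorem hasDerivAt_sub_mul_rpow_neg {r B a z : ℝ} (h : 0 < B - a * z) :
    HasDerivAt (fun z => (B - a * z) ^ (-r)) (r * a * (B - a * z) ^ (-(r + 1))) z := by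
  have h1 : HasDerivAt (fun z => B - a * z) (-a) z := by
    simpa using ((hasDerivAt_id z).const_mul a).const_sub B
  refine (h1.rpow_const (p := -r) (Or.inl h.ne')).congr_deriv ?_
  rw [show -r - 1 = -(r + 1) by ring]
  ring

theorem hasDerivAt_add_mul_rpow_neg {r B a z : ℝ} (h : 0 < B + a * z) :
    HasDerivAt (fun z => (B + a * z) ^ (-r)) (-(r * a * (B + a * z) ^ (-(r + 1)))) z := by
  have h1 := hasDerivAt_sub_mul_rpow_neg (r := r) (B := B) (a := -a) (z := z) (by linarith)
  simp only [neg_mul, sub_neg_eq_add] at h1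
  exact h1.congr_deriv (by ring)

theorem le_of_hasDerivAt_nonneg {f f' : ℝ → ℝ} {c : ℝ} (hc : 0 ≤ c)
    (hf : ∀ z ∈ Icc 0 c, HasDerivAt f (f' z) z) (hf' : ∀ z ∈ Icc 0 c, 0 ≤ f' z) : f 0 ≤ f c :=
  monotoneOn_of_hasDerivWithinAt_nonneg (convex_Icc 0 c)
    (fun z hz => (hf z hz).continuousAt.continuousWithinAt)
    (fun z hz => (hf z (interior_subset hz)).hasDerivWithinAt)
    (fun z hz => hf' z (interior_subset hz)) (left_mem_Icc.2 hc) (right_mem_Icc.2 hc) hc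

/-- The odd function `(B - z) ^ (-r) - (B + z) ^ (-r)` lies below its chords from the origin, because
its derivative is increasing. -/
theorem rpow_neg_symm_sub_le {r B a c : ℝ} (hr : 0 < r) (hc : 0 ≤ c) (hcB : c < B) (ha : 0 ≤ a)
    (ha1 : a ≤ 1) :
    (B - a * c) ^ (-r) - (B + a * c) ^ (-r) ≤ a * ((B - c) ^ (-r) - (B + c) ^ (-r)) := by
  have hpos : ∀ z ∈ Icc 0 c, 0 < B - a * z ∧ 0 < B + a * z ∧ 0 < B - 1 * z ∧ 0 < B + 1 * z :=
    fun z hz => by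
      have : a * z ≤ z := mul_le_of_le_one_left hz.1 ha1
      have : 0 ≤ a * z := mul_nonneg ha hz.1
      refine ⟨?_, ?_, ?_, ?_⟩ <;> linarith [hz.1, hz.2]
  have h := le_of_hasDerivAt_nonneg hc
    (fun z hz => ((((hasDerivAt_sub_mul_rpow_neg (r := r) (hpos z hz).2.2.1).sub
      (hasDerivAt_add_mul_rpow_neg (r := r) (hpos z hz).2.2.2)).const_mul a).sub
      ((hasDerivAt_sub_mul_rpow_neg (r := r) (hpos z hz).1).sub
      (hasDerivAt_add_mul_rpow_neg (r := r) (hpos z hz).2.1)))) (fun z hz => by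
        have := rpow_neg_symm_add_le (r := r + 1) (by linarith) hz.1 (hz.2.trans_lt hcB) ha ha1
        have h2 := mul_le_mul_of_nonneg_left this (mul_nonneg hr.le ha)
        simp only [one_mul]
        linarith)
  simp only [Pi.sub_apply, mul_zero, sub_zero, add_zero, one_mul, sub_self] at h
  linarith

/-- The even function `(B + z) ^ (-q) + (B - z) ^ (-q)` is convex as a function of `z ^ 2`: it lies
below the chord, with respect to `a ^ 2`, between `z = 0` and `z = c`. -/
theorem rpow_neg_symm_add_le_interp {q B a c : ℝ} (hq : 0 < q) (hc : 0 ≤ c) (hcB : c < B)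
    (ha : |a| ≤ 1) :
    (B + a * c) ^ (-q) + (B - a * c) ^ (-q) ≤
      (1 - a ^ 2) * (2 * B ^ (-q)) + a ^ 2 * ((B + c) ^ (-q) + (B - c) ^ (-q)) := by
  wlog ha0 : 0 ≤ a generalizing a
  · have := this (a := -a) (by rwa [abs_neg]) (by linarith)
    rw [neg_mul, sub_neg_eq_add, ← sub_eq_add_neg, neg_sq] at this
    linarith
  have ha1 : a ≤ 1 := (le_abs_self a).trans ha
  have hpos : ∀ z ∈ Icc 0 c, 0 < B - a * z ∧ 0 < B + a * z ∧ 0 < B - 1 * z ∧ 0 < B + 1 * z :=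
    fun z hz => by
      have : a * z ≤ z := mul_le_of_le_one_left hz.1 ha1
      have : 0 ≤ a * z := mul_nonneg ha0 hz.1
      refine ⟨?_, ?_, ?_, ?_⟩ <;> linarith [hz.1, hz.2]
  have h := le_of_hasDerivAt_nonneg hc
    (fun z hz => ((((hasDerivAt_sub_mul_rpow_neg (r := q) (hpos z hz).2.2.1).add
      (hasDerivAt_add_mul_rpow_neg (r := q) (hpos z hz).2.2.2)).const_mul (a ^ 2)).sub
      ((hasDerivAt_sub_mul_rpow_neg (r := q) (hpos z hz).1).add
      (hasDerivAt_add_mul_rpow_neg (r := q) (hpos z hz).2.1)))) (fun z hz => by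
        have := rpow_neg_symm_sub_le (r := q + 1) (by linarith) hz.1 (hz.2.trans_lt hcB) ha0 ha1
        have h2 := mul_le_mul_of_nonneg_left this (mul_nonneg hq.le ha0)
        simp only [one_mul]
        linarith)
  simp only [Pi.sub_apply, Pi.add_apply, mul_zero, sub_zero, add_zero, one_mul] at h
  linarith

theorem rpow_neg_eq_rpow_of_sq_eq {γ y A : ℝ} (hy : 0 ≤ y) (hA : y ^ 2 = A) :
    y ^ (-γ) = A ^ (-(γ / 2)) := by
  rw [← hA, ← Real.rpow_natCast, ← Real.rpow_mul hy]
  congr 1; push_cast; ring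

theorem two_mul_lt_one_add_sq {τ : ℝ} (hτ : τ ≠ 1) : 2 * τ < 1 + τ ^ 2 := by
  have : 0 < (1 - τ) ^ 2 := by
    have := sub_ne_zero.2 hτ.symm
    positivity
  linarith

theorem profileIntegrand_le_interp {s γ τ : ℝ} (hγ : 0 < γ) {e ξ : EuclideanSpace ℝ (Fin N)}
    (he : ‖e‖ = 1) (hξ : ‖ξ‖ = 1) (hτ : 0 < τ) (hτ1 : τ ≠ 1) :
    profileIntegrand s γ (fun τ => ‖e + τ • ξ‖) (fun τ => ‖e - τ • ξ‖) τ ≤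
      (1 - inner ℝ ξ e ^ 2) *
          profileIntegrand s γ (fun τ => √(1 + τ ^ 2)) (fun τ => √(1 + τ ^ 2)) τ +
        inner ℝ ξ e ^ 2 * profileIntegrand s γ (fun τ => 1 + τ) (fun τ => |1 - τ|) τ := by
  set a : ℝ := inner ℝ ξ e with ha
  have ha1 : |a| ≤ 1 := by
    have := abs_real_inner_le_norm ξ e
    rwa [he, hξ, mul_one] at this
  have n1 : ‖e + τ • ξ‖ ^ 2 = (1 + τ ^ 2) + a * (2 * τ) := by
    rw [norm_add_sq_real, he, norm_smul, hξ, inner_smul_right, real_inner_comm, ← ha,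
      Real.norm_of_nonneg hτ.le]
    ring
  have n2 : ‖e - τ • ξ‖ ^ 2 = (1 + τ ^ 2) - a * (2 * τ) := by
    rw [norm_sub_sq_real, he, norm_smul, hξ, inner_smul_right, real_inner_comm, ← ha,
      Real.norm_of_nonneg hτ.le]
    ring
  have n3 : √(1 + τ ^ 2) ^ 2 = 1 + τ ^ 2 := Real.sq_sqrt (by positivity)
  have n4 : (1 + τ) ^ 2 = (1 + τ ^ 2) + 2 * τ := by ring
  have n5 : |1 - τ| ^ 2 = (1 + τ ^ 2) - 2 * τ := by rw [sq_abs]; ring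
  have key := rpow_neg_symm_add_le_interp (q := γ / 2) (by linarith)
    (show 0 ≤ 2 * τ by linarith) (two_mul_lt_one_add_sq hτ1) ha1
  have hw : 0 ≤ τ ^ (-(1 + 2 * s)) := Real.rpow_nonneg hτ.le _
  simp only [profileIntegrand]
  rw [rpow_neg_eq_rpow_of_sq_eq (norm_nonneg _) n1, rpow_neg_eq_rpow_of_sq_eq (norm_nonneg _) n2,
    rpow_neg_eq_rpow_of_sq_eq (Real.sqrt_nonneg _) n3,
    rpow_neg_eq_rpow_of_sq_eq (by linarith) n4, rpow_neg_eq_rpow_of_sq_eq (abs_nonneg _) n5]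
  linarith [mul_le_mul_of_nonneg_right key hw]

theorem cPerp_le_cRadial {s γ : ℝ} (hs : 1 / 2 < s) (hs' : s < 1) (hγ : 0 < γ) (hγ1 : γ < 1) :
    cPerp s γ ≤ cRadial s γ := by
  have hab : |γ| < 1 := by rwa [abs_of_pos hγ]
  rw [cPerp_eq, cRadial_eq]
  refine mul_le_mul_of_nonneg_left ?_ (fracConst_pos (by linarith) hs').le
  refine integral_mono_ae (isDistanceProfile_perp.integrableOn_profileIntegrand hs hs' hab)
    (isDistanceProfile_radial.integrableOn_profileIntegrand hs hs' hab) ?_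
  filter_upwards [ae_pos_ne_one] with τ ⟨hτ, hτ1⟩
  have key := rpow_neg_symm_add_le (r := γ / 2) (a := 0) (by linarith)
    (show 0 ≤ 2 * τ by linarith) (two_mul_lt_one_add_sq hτ1) le_rfl zero_le_one
  rw [zero_mul, sub_zero, add_zero] at key
  have hw : 0 ≤ τ ^ (-(1 + 2 * s)) := Real.rpow_nonneg hτ.le _
  simp only [profileIntegrand]
  rw [rpow_neg_eq_rpow_of_sq_eq (Real.sqrt_nonneg _)
      (Real.sq_sqrt (by positivity : 0 ≤ 1 + τ ^ 2)),
    rpow_neg_eq_rpow_of_sq_eq (y := 1 + τ) (A := 1 + τ ^ 2 + 2 * τ) (by linarith) (by ring),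
    rpow_neg_eq_rpow_of_sq_eq (y := |1 - τ|) (A := 1 + τ ^ 2 - 2 * τ) (abs_nonneg _)
      (by rw [sq_abs]; ring)]
  linarith [mul_le_mul_of_nonneg_right key hw]

/-- In a direction making the angle `θ` with `e`, the operator on `|x| ^ (-γ)` is at most the
combination, with weights `sin θ ^ 2` and `cos θ ^ 2`, of the orthogonal and the radial ones. -/
theorem fracConst_mul_integral_profile_le {s γ : ℝ} (hs : 1 / 2 < s) (hs' : s < 1) (hγ : 0 < γ)
    (hγ1 : γ < 1) {e ξ : EuclideanSpace ℝ (Fin N)} (he : ‖e‖ = 1) (hξ : ‖ξ‖ = 1) :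
    fracConst s *
        ∫ τ in Ioi 0, profileIntegrand s γ (fun τ => ‖e + τ • ξ‖) (fun τ => ‖e - τ • ξ‖) τ ≤
      (1 - inner ℝ ξ e ^ 2) * cPerp s γ + inner ℝ ξ e ^ 2 * cRadial s γ := by
  have hab : |γ| < 1 := by rwa [abs_of_pos hγ]
  have i₁ := isDistanceProfile_perp.integrableOn_profileIntegrand hs hs' hab
  have i₂ := isDistanceProfile_radial.integrableOn_profileIntegrand hs hs' hab
  rw [cPerp_eq, cRadial_eq, mul_left_comm, mul_left_comm _ (fracConst s), ← mul_add,
    ← integral_const_mul (1 - _), ← integral_const_mul (inner ℝ ξ e ^ 2),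
    ← integral_add (i₁.const_mul _) (i₂.const_mul _)]
  refine mul_le_mul_of_nonneg_left ?_ (fracConst_pos (by linarith) hs').le
  refine integral_mono_ae ((isDistanceProfile_norm he hξ).integrableOn_profileIntegrand hs hs' hab)
    ((i₁.const_mul _).add (i₂.const_mul _)) ?_
  filter_upwards [ae_pos_ne_one] with τ ⟨hτ, hτ1⟩
  exact profileIntegrand_le_interp hγ he hξ hτ hτ1

/-- By Bessel's inequality the total weight of the radial coefficient is at most one, so that a frame
containing the radial direction is the worst case. -/
theorem sum_fracConst_mul_integral_profile_le {s γ : ℝ} (hs : 1 / 2 < s) (hs' : s < 1)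
    (hγ : 0 < γ) (hγ1 : γ < 1) {k : ℕ} {e : EuclideanSpace ℝ (Fin N)} (he : ‖e‖ = 1)
    {ξ : Fin k → EuclideanSpace ℝ (Fin N)} (hξ : Orthonormal ℝ ξ) :
    ∑ i, (fracConst s * ∫ τ in Ioi 0,
        profileIntegrand s γ (fun τ => ‖e + τ • ξ i‖) (fun τ => ‖e - τ • ξ i‖) τ) ≤
      cExtremal s k γ := by
  have hbessel : ∑ i, inner ℝ (ξ i) e ^ 2 ≤ 1 := by
    have := hξ.sum_inner_products_le e (s := Finset.univ)
    simpa [he] using this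
  calc _ ≤ ∑ i, ((1 - inner ℝ (ξ i) e ^ 2) * cPerp s γ + inner ℝ (ξ i) e ^ 2 * cRadial s γ) :=
        Finset.sum_le_sum fun i _ => fracConst_mul_integral_profile_le hs hs' hγ hγ1 he (hξ.1 i)
    _ = ∑ i, (cPerp s γ + inner ℝ (ξ i) e ^ 2 * (cRadial s γ - cPerp s γ)) :=
        Finset.sum_congr rfl fun i _ => by ring
    _ = k * cPerp s γ + (∑ i, inner ℝ (ξ i) e ^ 2) * (cRadial s γ - cPerp s γ) := by
        rw [Finset.sum_add_distrib, ← Finset.sum_mul]; simp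
    _ ≤ k * cPerp s γ + 1 * (cRadial s γ - cPerp s γ) := by
        have := sub_nonneg.2 (cPerp_le_cRadial hs hs' hγ hγ1)
        gcongr
    _ = cExtremal s k γ := by rw [cExtremal]; ring

/-! ### The truncated power as a supersolution -/

theorem truncPower_le_one (γ : ℝ) (x : EuclideanSpace ℝ (Fin N)) : truncPower γ x ≤ 1 := by
  unfold truncPower
  split_ifs
  · exact le_rfl
  · exact min_le_left _ _

theorem truncPower_nonneg (γ : ℝ) (x : EuclideanSpace ℝ (Fin N)) : 0 ≤ truncPower γ x := by
  unfold truncPower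
  split_ifs <;> positivity

theorem truncPower_le_rpow (γ : ℝ) {x : EuclideanSpace ℝ (Fin N)} (hx : x ≠ 0) :
    truncPower γ x ≤ ‖x‖ ^ (-γ) := by
  rw [truncPower, if_neg hx]
  exact min_le_right _ _

/-- A formula valid at the origin as well. -/
theorem truncPower_eq_max {γ : ℝ} (hγ : 0 < γ) (x : EuclideanSpace ℝ (Fin N)) :
    truncPower γ x = max 1 ‖x‖ ^ (-γ) := by
  unfold truncPower
  split_ifs with h
  · simp [h]
  · have hx : 0 < ‖x‖ := norm_pos_iff.2 h
    rcases le_total ‖x‖ 1 with h1 | h1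
    · rw [max_eq_left h1, Real.one_rpow, min_eq_left]
      exact Real.one_le_rpow_of_pos_of_le_one_of_nonpos hx h1 (by linarith)
    · rw [max_eq_right h1, min_eq_right]
      exact Real.rpow_le_one_of_one_le_of_nonpos h1 (by linarith)

theorem continuous_truncPower {γ : ℝ} (hγ : 0 < γ) :
    Continuous (truncPower γ : EuclideanSpace ℝ (Fin N) → ℝ) := by
  rw [funext (truncPower_eq_max hγ)]
  exact (continuous_const.max continuous_norm).rpow_const fun x =>
    Or.inl (lt_max_of_lt_left one_pos).ne'

theorem ae_add_smul_ne_zero {x ξ : EuclideanSpace ℝ (Fin N)} (hξ : ‖ξ‖ = 1) :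
    ∀ᵐ τ : ℝ, x + τ • ξ ≠ 0 := by
  have h : ∀ᵐ τ : ℝ, τ ≠ -inner ℝ ξ x := by simp [ae_iff]
  filter_upwards [h] with τ hτ h0
  apply hτ
  have : inner ℝ ξ (x + τ • ξ) = 0 := by rw [h0, inner_zero_right]
  rw [inner_add_right, inner_smul_right, real_inner_self_eq_norm_sq, hξ] at this
  linarith

theorem sum_le_coe_sum_of_le {ι : Type*} (t : Finset ι) {f : ι → EReal} {g : ι → ℝ}
    (h : ∀ i ∈ t, f i ≤ (g i : EReal)) : ∑ i ∈ t, f i ≤ ((∑ i ∈ t, g i : ℝ) : EReal) := by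
  induction t using Finset.cons_induction with
  | empty => simp
  | cons i t hi ih =>
    rw [Finset.sum_cons, Finset.sum_cons, EReal.coe_add]
    exact add_le_add (h i (Finset.mem_cons_self i t))
      (ih fun j hj => h j (Finset.mem_cons_of_mem hj))

/-- If `φ` touches `u` from below at `x` and `u` grows from `x` no more than `v` does along the line
with direction `ξ`, the operator evaluated with `u` and `φ` is at most the operator of `v`. The
second condition may fail on a null set of the line, such as its intersection with the origin. -/
theorem pvExtIntegral_add_extIntegral_le {s δ : ℝ} (hs : 0 < s) (hs' : s < 1)
    {u φ v : EuclideanSpace ℝ (Fin N) → ℝ} {x ξ : EuclideanSpace ℝ (Fin N)} (hξ : ‖ξ‖ = 1)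
    (hmin : IsMinOn (fun y => u y - φ y) (Metric.ball x δ) x)
    (huv : ∀ᵐ τ : ℝ, u (x + τ • ξ) - u x ≤ v (x + τ • ξ) - v x) :
    pvExtIntegral δ (lineIntegrand s φ x ξ) + extIntegral (Ioo (-δ) δ)ᶜ (lineIntegrand s u x ξ) ≤
      pvExtIntegral δ (lineIntegrand s v x ξ) +
        extIntegral (Ioo (-δ) δ)ᶜ (lineIntegrand s v x ξ) := by
  have hC := fracConst_pos hs hs'
  have hline : ∀ {f g : EuclideanSpace ℝ (Fin N) → ℝ} {τ : ℝ},
      f (x + τ • ξ) - f x ≤ g (x + τ • ξ) - g x →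
        lineIntegrand s f x ξ τ ≤ lineIntegrand s g x ξ τ := fun h => by
    unfold lineIntegrand; gcongr
  have huv' : ∀ᵐ τ : ℝ, u (x + (-τ) • ξ) - u x ≤ v (x + (-τ) • ξ) - v x :=
    (Measure.measurePreserving_neg (volume : Measure ℝ)).quasiMeasurePreserving.ae huv
  have hφ : ∀ τ, |τ| < δ → φ (x + τ • ξ) - φ x ≤ u (x + τ • ξ) - u x := fun τ hτ => by
    have : x + τ • ξ ∈ Metric.ball x δ := by
      rw [Metric.mem_ball, dist_eq_norm, add_sub_cancel_left, norm_smul, hξ, mul_one]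
      exact hτ
    have := hmin this
    simp only [mem_ofPred_eq] at this
    linarith
  refine add_le_add (extIntegral_mono_ae ?_) (extIntegral_mono_ae ?_)
  · filter_upwards [ae_restrict_mem measurableSet_Ioo, ae_restrict_of_ae huv,
      ae_restrict_of_ae huv'] with τ hτ h1 h2
    have ht : |τ| < δ := by rw [abs_of_pos hτ.1]; exact hτ.2
    exact add_le_add (hline ((hφ τ ht).trans h1)) (hline ((hφ (-τ) (by rwa [abs_neg])).trans h2))
  · filter_upwards [ae_restrict_of_ae huv] with τ h1
    exact hline h1

theorem isViscositySupersolution_truncPower {s γ : ℝ} (hs : 1 / 2 < s) (hs' : s < 1)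
    (hγ : 0 < γ) (hγ1 : γ < 1) {k : ℕ} (hc : cExtremal s k γ ≤ 0) :
    IsViscositySupersolution s k (truncPower γ : EuclideanSpace ℝ (Fin N) → ℝ) := by
  refine ⟨(continuous_truncPower hγ).lowerSemicontinuous, fun x δ φ hδ _ hmin => ?_⟩
  refine iSup_le fun ξ => ?_
  obtain ⟨ξ, hξ⟩ := ξ
  -- in the closed unit ball `u` attains its maximum `1`; outside it, `u` is compared with the power
  rcases le_or_gt ‖x‖ 1 with hx | hx
  · have hux : truncPower γ x = 1 := by rw [truncPower_eq_max hγ, max_eq_left hx, Real.one_rpow]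
    refine Finset.sum_nonpos fun i _ => ?_
    have h := pvExtIntegral_add_extIntegral_le (s := s) (v := fun _ => 0) (by linarith) hs'
      (hξ.1 i) hmin (.of_forall fun τ => by
        have := truncPower_le_one γ (x + τ • ξ i)
        rw [hux]; linarith)
    have h0 : lineIntegrand s (fun _ => 0) x (ξ i) = fun _ => 0 := by
      funext τ; simp [lineIntegrand]
    refine h.trans (le_of_eq ?_)
    simp [h0, pvExtIntegral, extIntegral]
  · set R := ‖x‖ with hR
    have hR0 : 0 < R := one_pos.trans hx
    set e := R⁻¹ • x with he
    have hRe : R • e = x := by rw [he, smul_smul, mul_inv_cancel₀ hR0.ne', one_smul]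
    have hen : ‖e‖ = 1 := by
      rw [he, norm_smul, ← hR, norm_inv, Real.norm_of_nonneg hR0.le, inv_mul_cancel₀ hR0.ne']
    have hux : truncPower γ x = R ^ (-γ) := by
      rw [truncPower_eq_max hγ, ← hR, max_eq_right hx.le]
    refine (sum_le_coe_sum_of_le Finset.univ (g := fun i => R ^ (-γ - 2 * s) * (fracConst s *
      ∫ τ in Ioi 0, profileIntegrand s γ (fun τ => ‖e + τ • ξ i‖) (fun τ => ‖e - τ • ξ i‖) τ))
      fun i _ => ?_).trans ?_
    · have h := pvExtIntegral_add_extIntegral_le (s := s) (v := fun y => ‖y‖ ^ (-γ))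
        (by linarith) hs' (hξ.1 i) hmin (by
          filter_upwards [ae_add_smul_ne_zero (x := x) (hξ.1 i)] with τ hτ
          have := truncPower_le_rpow γ hτ
          rw [hux]; linarith)
      obtain ⟨h1, h2, h3⟩ := integral_lineIntegrand_rpow (γ := γ) hs hs'
        (by rwa [abs_of_pos hγ]) hen (hξ.1 i) hR0 hδ rfl
      rw [hRe] at h1 h2 h3
      rw [pvExtIntegral_add_extIntegral hδ h1 h2, h3] at h
      exact h
    · rw [← Finset.mul_sum]
      have := (sum_fracConst_mul_integral_profile_le hs hs' hγ hγ1 hen hξ).trans hc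
      exact_mod_cast mul_nonpos_of_nonneg_of_nonpos (by positivity) this

theorem not_const_truncPower {γ : ℝ} (hγ : 0 < γ) (hN : 1 ≤ N) :
    ¬ ∃ c : ℝ, ∀ x : EuclideanSpace ℝ (Fin N), truncPower γ x = c := by
  rintro ⟨c, hc⟩
  have h1 := (hc 0).trans (hc (EuclideanSpace.single ⟨0, hN⟩ 2)).symm
  rw [truncPower_eq_max hγ, truncPower_eq_max hγ, PiLp.norm_single] at h1
  norm_num at h1
  exact absurd h1 (Real.rpow_lt_one_of_one_lt_of_neg one_lt_two (by linarith)).ne'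

end

theorem mainTheorem4 (N : ℕ) (hN : 1 ≤ N) (s : ℝ) (hs : 1 / 2 < s) (hs' : s < 1) :
    (∀ u : EuclideanSpace ℝ (Fin N) → ℝ,
      IsViscositySupersolution s 1 u → BddBelow (Set.range u) → ∃ c : ℝ, ∀ x, u x = c) ∧
    (∀ k : ℕ, 2 ≤ k → k ≤ N →
      ∃ γbar : ℝ, (0 < γbar ∧ γbar < 1 ∧ cExtremal s k γbar = 0) ∧
        (∀ γ : ℝ, 0 < γ → γ < 1 → cExtremal s k γ = 0 → γ = γbar) ∧
        ∀ γ : ℝ, 0 < γ → γ < γbar →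
          IsViscositySupersolution s k (truncPower γ : EuclideanSpace ℝ (Fin N) → ℝ) ∧
          BddBelow (Set.range (truncPower γ : EuclideanSpace ℝ (Fin N) → ℝ)) ∧
          ¬ ∃ c : ℝ, ∀ x : EuclideanSpace ℝ (Fin N), truncPower γ x = c) := by
  refine ⟨fun u hu hb => eq_const_of_isViscositySupersolution_one hs hs' hu hb,
    fun k hk _ => ?_⟩
  obtain ⟨γbar, h1, h2, h3⟩ := exists_unique_zero_cExtremal hs hs' hk
  refine ⟨γbar, h1, h2, fun γ h0 hlt => ⟨isViscositySupersolution_truncPower hs hs' h0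
    (hlt.trans h1.2.1) (h3 γ h0 hlt).le, ⟨0, ?_⟩, not_const_truncPower h0 hN⟩⟩
  rintro _ ⟨x, rfl⟩
  exact truncPower_nonneg γ x
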